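/- An *incomplete binary tree* is a finite rooted tree in which each vertex has a possibly empty left subtree and a possibly empty right subtree. Once the root has been given a label, the other vertices are labelled so that a left child has the label of its parent minus one and a right child the label of its parent plus one. Edges are oriented away from the root, and $|t|$ denotes the number of edges of $t$. Fix $V\ge 1$, and let $T$ be uniformly distributed on the incomplete binary trees with $V$ edges, with root label $0$; write $\Pi_0^{(V)}$ for its law. For $m\ge 1$ let $X_m^+$ (resp. $X_m^-$) be the number of oriented edges of $T$ from label $m-1$ to label $m$ (resp. from label $m$ to label $m-1$), and let $M_m^-$ be the number of edges whose two endpoints both have label at most $m-1$. Put $\bar{\mathcal X}_m=(X_m^+,X_m^-,M_m^-)$ and $$\mathfrak S^{(V)}=(\mathbb N_{>0}\times\mathbb N_{\ge 0}\times\{0,1,\dots,V\})\cup\{(0,0,V)\}.$$ Let $\Pi^+$ be the law of the following random tree $\tau$: start from one root vertex with label $1$, let each vertex have a left child with probability $1/2$ and, independently, a right child with probability $1/2$, and finally delete all strict descendants of vertices with label $0$. Let $n_\tau$ be the number of vertices of $\tau$ with label $0$. For integers $p,q\ge 0$ and $l\in\mathbb Z$ let $$\tilde f_p(q,l)=\mathbb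 P\Big(\sum_{k=1}^p n_{\tau_k}=q,\ \sum_{k=1}^p|\tau_k|=l\Big),$$ where $\tau_1,\dots,\tau_p$ are i.i.d. with law $\Pi^+$ (so $\tilde f_p(q,l)=0$ if $l<0$, and $\tilde f_0(q,l)=\mathbf 1_{\{q=l=0\}}$). **Theorem.** Under $\Pi_0^{(V)}$ the process $(\bar{\mathcal X}_m)_{m\ge 1}$ is a time-homogeneous Markov chain with the following transition kernel. Let $(p,q,v),(r,s,w)\in\mathfrak S^{(V)}$ and let $m\ge 1$ be such that $\Pi_0^{(V)}(\bar{\mathcal X}_m=(p,q,v))>0$. Then $\tilde f_p(q,V-v-p)>0$ and $$\Pi_0^{(V)}\big(\bar{\mathcal X}_{m+1}=(r,s,w)\,\big|\,\bar{\mathcal X}_m=(p,q,v)\big)=\begin{cases}\dfrac{p\,4^{-p-s}}{p+s}\dbinom{p+s}{r}\dbinom{p+s}{q}\dfrac{\tilde f_r(s,V-w-r)}{\tilde f_p(q,V-v-p)}&\text{if } w=v+p+q,\\[2mm]0&\text{otherwise,}\end{cases}$$ where the first line is read as $1$ if $p=q=r=s=0$, and as $0$ if $p=s=0$ and $r\geq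 1$. Moreover, the same value is obtained if one conditions on $\{\bar{\mathcal X}_k=x_k \text{ for all } 1\le k\le m\}$ instead, for any $x_1,\dots,x_m$ with $x_m=(p,q,v)$ such that this event has positive probability. -/

import Mathlib

open MeasureTheory ProbabilityTheory
open scoped ENNReal

noncomputable section

namespace EdgeProfile

/-- Incomplete binary trees: a vertex is a `node` and `nil` stands for an absent subtree, so that a
tree (which has at least its root vertex) is a term different from `nil`. -/
abbrev BTree : Type := BinaryTree Unit

instance : MeasurableSpace BTree := ⊤

/-- The number `|t|` of edges of a nonempty tree `t`. -/
def numEdges (t : BTree) : ℕ := t.numNodes - 1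

/-- The multiset of vertex labels of the tree whose root has label `x`: a left child has the label
of its parent minus one, a right child the label of its parent plus one. -/
def labels : ℤ → BTree → Multiset ℤ
  | _, .nil => 0
  | x, .node _ l r => x ::ₘ (labels (x - 1) l + labels (x + 1) r)

/-- The edge from a parent labelled `x` to the root, labelled `y`, of a possibly absent subtree. -/
def edgeTo (x y : ℤ) : BTree → Multiset (ℤ × ℤ)
  | .nil => 0
  | .node _ _ _ => {(x, y)}

/-- The multiset of the pairs (label of parent, label of child) over all edges of the tree whose
root has label `x`. -/
def edges : ℤ → BTree → Multiset (ℤ × ℤ)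
  | _, .nil => 0
  | x, .node _ l r =>
      edgeTo x (x - 1) l + edgeTo x (x + 1) r + (edges (x - 1) l + edges (x + 1) r)

/-- `X_m^+`: number of edges from label `m - 1` to label `m`, the root being labelled `0`. -/
def upCount (m : ℕ) (t : BTree) : ℕ := (edges 0 t).count ((m : ℤ) - 1, (m : ℤ))

/-- `X_m^-`: number of edges from label `m` to label `m - 1`, the root being labelled `0`. -/
def downCount (m : ℕ) (t : BTree) : ℕ := (edges 0 t).count ((m : ℤ), (m : ℤ) - 1)

/-- `M_m^-`: number of edges with both labels at most `m - 1`, the root being labelled `0`. -/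
def massBelow (m : ℕ) (t : BTree) : ℕ :=
  (edges 0 t).countP fun e => e.1 ≤ (m : ℤ) - 1 ∧ e.2 ≤ (m : ℤ) - 1

/-- The triple `(X_m^+, X_m^-, M_m^-)`. -/
def profile (m : ℕ) (t : BTree) : ℕ × ℕ × ℕ := (upCount m t, downCount m t, massBelow m t)

/-- The state space of the process `(X_m^+, X_m^-, M_m^-)` for trees with `V` edges. -/
def stateSpace (V : ℕ) : Set (ℕ × ℕ × ℕ) :=
  {x | 0 < x.1 ∧ x.2.2 ≤ V} ∪ {(0, 0, V)}

/-- The uniform distribution on incomplete binary trees with `V` edges. -/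
def uniformTree (V : ℕ) : Measure BTree :=
  uniformOn {t : BTree | t ≠ .nil ∧ numEdges t = V}

/-- The law of the random binary tree in which each vertex has a left child with probability `1/2`
and, independently, a right child with probability `1/2`: every vertex of a tree contributes a
factor `1/4`, so a nonempty tree `t` has probability `4 ^ (-|t| - 1)`. -/
def treeLaw : Measure BTree :=
  Measure.sum fun t : {t : BTree // t ≠ .nil} =>
    ((4 : ℝ≥0∞)⁻¹ ^ (numEdges t.1 + 1)) • Measure.dirac t.1

/-- Truncation at level `0` of the tree whose root has label `x`: all strict descendants of the
vertices with label `0` are deleted. -/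
def truncate : ℤ → BTree → BTree
  | _, .nil => .nil
  | x, .node a l r =>
      if x = 0 then .node a .nil .nil
      else .node a (truncate (x - 1) l) (truncate (x + 1) r)

/-- `Π^+`: the law of the truncation at level `0` of the random binary tree with root label `1`. -/
def excursionLaw : Measure BTree := treeLaw.map (truncate 1)

/-- `n_τ`: the number of vertices with label `0` in the tree `τ` with root label `1`. -/
def zeroCount (τ : BTree) : ℕ := (labels 1 τ).count 0

/-- The probability that `p` independent excursions `τ₁, …, τ_p` with law `Π^+` satisfy
`n_{τ₁} + ⋯ + n_{τ_p} = q` and `|τ₁| + ⋯ + |τ_p| = l`. -/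
def jointLaw (p q : ℕ) (l : ℤ) : ℝ :=
  (Measure.pi fun _ : Fin p => excursionLaw).real
    {τ | ∑ k, zeroCount (τ k) = q ∧ ((∑ k, numEdges (τ k) : ℕ) : ℤ) = l}

end EdgeProfile

end

/-! Cut a tree at its vertices of label `m ≥ 1`. Labels move by ±1, so besides the part around the
root there remain pieces lying entirely below or entirely above level `m`, each hanging by one edge
from a vertex of label `m`. If `X_m^+ = p` and `X_{m+1}^- = s`, there are `p + s` such vertices,
carrying `q = X_m^-` lower and `r = X_{m+1}^+` upper pieces. They form a forest of `k` trees, where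
`k` counts those without a strict ancestor of label `m`. By the Otter–Dwass formula
(`iterSum_otterDwass`, `iterSum_rootedEdges`) the number of forests is `k/(p+s) * C(p+s,q) *
C(p+s,r)` times the number of pairs of tuples of pieces with the right totals. Hence the number of
trees with a prescribed past and given `(r, s)` is a product of these binomials, a weight of the
past alone, and a number of `r`-tuples of excursions (`treeCount_mul`).

The same count for `p` excursions cut at label 1 (`excursionCount_eq_tsum`) evaluates the sum over
`(r, s)` (`treeCount_mul_eq`). In the quotient the weight of the past cancels: this is the Markov
property, and what remains is the kernel. All tuples of excursions counted by `jointLaw` have the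
same probability, a power of 4 (`jointLaw_eq`), which accounts for the factor `4^(-p-s)`.

Trees enter only through their multisets of edges, on which all statistics are additive. Sums take
values in `ℝ≥0∞`, so that they can be reordered freely. -/

noncomputable section

namespace EdgeProfile

/-! ### Sums over tuples and the Otter–Dwass formula. -/

section IterSum

variable {A B ι κ : Type*} [AddCommMonoid A] [AddCommMonoid B]

/-- The sum of `φ (e i₁ + ⋯ + e iₖ)` over all `k`-tuples of indices. -/
def iterSum (e : ι → A) : ℕ → (A → ℝ≥0∞) → ℝ≥0∞
  | 0, φ => φ 0
  | k + 1, φ => ∑' i, iterSum e k fun a => φ (e i + a)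

theorem iterSum_succ (e : ι → A) (k : ℕ) (φ : A → ℝ≥0∞) :
    iterSum e (k + 1) φ = ∑' i, iterSum e k fun a => φ (e i + a) := rfl

theorem iterSum_one (e : ι → A) (φ : A → ℝ≥0∞) : iterSum e 1 φ = ∑' i, φ (e i) := by
  simp [iterSum]

theorem iterSum_fun_zero (e : ι → A) (k : ℕ) : iterSum e k (fun _ => 0) = 0 := by
  induction k with
  | zero => rfl
  | succ k ih => simp [iterSum, ih]

theorem iterSum_fun_add (e : ι → A) (k : ℕ) (φ ψ : A → ℝ≥0∞) :
    iterSum e k (fun a => φ a + ψ a) = iterSum e k φ + iterSum e k ψ := by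
  induction k generalizing φ ψ with
  | zero => rfl
  | succ k ih => simp only [iterSum, ih, ENNReal.tsum_add]

theorem iterSum_const_mul (e : ι → A) (k : ℕ) (c : ℝ≥0∞) (φ : A → ℝ≥0∞) :
    iterSum e k (fun a => c * φ a) = c * iterSum e k φ := by
  induction k generalizing φ with
  | zero => rfl
  | succ k ih => simp only [iterSum, ih, ENNReal.tsum_mul_left]

theorem iterSum_mul_const (e : ι → A) (k : ℕ) (c : ℝ≥0∞) (φ : A → ℝ≥0∞) :
    iterSum e k (fun a => φ a * c) = iterSum e k φ * c := by
  simp only [mul_comm _ c, iterSum_const_mul]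

theorem iterSum_fun_tsum (e : ι → A) (k : ℕ) (φ : κ → A → ℝ≥0∞) :
    iterSum e k (fun a => ∑' j, φ j a) = ∑' j, iterSum e k (φ j) := by
  induction k generalizing φ with
  | zero => rfl
  | succ k ih =>
    simp only [iterSum, ih]
    exact ENNReal.tsum_comm

theorem iterSum_add (e : ι → A) (j k : ℕ) (φ : A → ℝ≥0∞) :
    iterSum e (j + k) φ = iterSum e j fun a => iterSum e k fun b => φ (a + b) := by
  induction j generalizing φ with
  | zero => simp [iterSum]
  | succ j ih =>
    rw [Nat.add_right_comm]
    simp only [iterSum, ih, add_assoc]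

theorem iterSum_congr_of_mem {e : ι → A} (P : AddSubmonoid A) (he : ∀ i, e i ∈ P) (k : ℕ)
    {φ ψ : A → ℝ≥0∞} (h : ∀ a ∈ P, φ a = ψ a) : iterSum e k φ = iterSum e k ψ := by
  induction k generalizing φ ψ with
  | zero => exact h 0 P.zero_mem
  | succ k ih => exact tsum_congr fun i => ih fun a ha => h _ (P.add_mem (he i) ha)

/-- Exchangeability: each of the `k + 1` terms has the same contribution to `γ`. -/
theorem iterSum_weight (e : ι → A) (γ : A →+ ℕ) (k : ℕ) (φ : A → ℝ≥0∞) :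
    iterSum e (k + 1) (fun a => γ a * φ a) =
      (k + 1 : ℕ) * ∑' i, γ (e i) * iterSum e k fun a => φ (e i + a) := by
  induction k generalizing φ with
  | zero => simp [iterSum]
  | succ k ih =>
    rw [iterSum_succ]
    simp only [map_add, Nat.cast_add, add_mul, iterSum_fun_add, iterSum_const_mul,
      ENNReal.tsum_add]
    simp only [ih fun a => φ (e _ + a), ENNReal.tsum_mul_left]
    rw [ENNReal.tsum_comm]
    simp only [ENNReal.tsum_mul_left, iterSum_succ, add_left_comm]
    push_cast
    ring

theorem tsum_option_ennreal (f : Option ι → ℝ≥0∞) :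
    ∑' o, f o = f none + ∑' i, f (some i) := by
  classical
  rw [ENNReal.tsum_eq_add_tsum_ite none]
  congr 1
  rw [← (Option.some_injective ι).tsum_eq]
  · simp
  · intro o ho
    cases o with
    | none => simp at ho
    | some i => exact ⟨i, rfl⟩

/-- Each nonempty slot adds 1 to `χ`, so exactly `q` of the `n` slots are filled, and the sum does
not depend on which. Pascal's rule drives the induction. -/
theorem iterSum_option {e : ι → A} (χ : A →+ ℕ) (he : ∀ i, χ (e i) = 1) (n q : ℕ)
    {φ : A → ℝ≥0∞} (hφ : ∀ a, φ a ≠ 0 → χ a = q) :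
    iterSum (fun o : Option ι => o.elim 0 e) n φ = n.choose q * iterSum e q φ := by
  induction n generalizing q φ with
  | zero =>
    cases q with
    | zero => simp [iterSum]
    | succ q =>
      have : φ 0 = 0 := by
        by_contra h
        simpa using hφ 0 h
      simp [iterSum, this]
  | succ n ih =>
    rw [iterSum_succ, tsum_option_ennreal]
    simp only [Option.elim_none, zero_add, Option.elim_some]
    rw [ih q hφ]
    cases q with
    | zero =>
      have h0 : ∀ i a, φ (e i + a) = 0 := by
        intro i a
        by_contra h
        have := hφ _ h
        simp [he] at this
      simp [h0, iterSum_fun_zero]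
    | succ q =>
      have h1 : ∀ i a, φ (e i + a) ≠ 0 → χ a = q := by
        intro i a h
        have := hφ _ h
        rw [map_add, he] at this
        omega
      simp only [fun i => ih q (h1 i), ENNReal.tsum_mul_left]
      rw [← iterSum_succ, Nat.choose_succ_succ]
      push_cast
      ring

theorem iterSum_prod (e : ι → A) (f : κ → A) (n : ℕ) (φ : A → ℝ≥0∞) :
    iterSum (fun i : ι × κ => e i.1 + f i.2) n φ =
      iterSum e n fun a => iterSum f n fun b => φ (a + b) := by
  induction n generalizing φ with
  | zero => simp [iterSum]
  | succ n ih =>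
    rw [iterSum_succ, ENNReal.tsum_prod']
    simp only [ih, iterSum_succ, iterSum_fun_tsum, add_assoc, add_left_comm]

theorem iterSum_comp (e : ι → A) (h : A →+ B) (k : ℕ) (φ : B → ℝ≥0∞) :
    iterSum e k (fun a => φ (h a)) = iterSum (fun i => h (e i)) k φ := by
  induction k generalizing φ with
  | zero => simp [iterSum]
  | succ k ih =>
    simp only [iterSum, map_add]
    exact tsum_congr fun i => ih fun b => φ (h (e i) + b)

/-- `P` is closed under summands, so a tuple whose total lies in the support of `φ` has all its
terms in `P`. -/
theorem iterSum_subtype (e : ι → A) (P : AddSubmonoid A) (hP : ∀ a b, a + b ∈ P → a ∈ P ∧ b ∈ P)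
    (k : ℕ) {φ : A → ℝ≥0∞} (hφ : ∀ a, φ a ≠ 0 → a ∈ P) :
    iterSum e k φ = iterSum (fun i : {i // e i ∈ P} => e i) k φ := by
  induction k generalizing φ with
  | zero => rfl
  | succ k ih =>
    simp only [iterSum]
    have h0 : ∀ i, e i ∉ P → (iterSum e k fun a => φ (e i + a)) = 0 := by
      intro i hi
      rw [← iterSum_fun_zero e k]
      congr 1
      funext a
      by_contra h
      exact hi (hP _ _ (hφ _ h)).1
    rw [← tsum_subtype_eq_of_support_subset (s := {i | e i ∈ P})]
    · exact tsum_congr fun i => ih fun a h => (hP _ _ (hφ _ h)).2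
    · intro i hi
      by_contra h
      exact hi (h0 i h)

theorem iterSum_multiplicative (e : ι → A) (w : Multiplicative A →* ℝ≥0∞) (k : ℕ) :
    iterSum e k (fun a => w (Multiplicative.ofAdd a)) =
      (∑' i, w (Multiplicative.ofAdd (e i))) ^ k := by
  induction k with
  | zero => simp [iterSum]
  | succ k ih =>
    simp only [iterSum, ofAdd_add, map_mul, iterSum_const_mul, ih, ENNReal.tsum_mul_right]
    ring

theorem tsum_fin_eq_iterSum (e : ι → A) (k : ℕ) (φ : A → ℝ≥0∞) :
    ∑' f : Fin k → ι, φ (∑ j, e (f j)) = iterSum e k φ := by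
  induction k generalizing φ with
  | zero => simp [iterSum, tsum_fintype]
  | succ k ih =>
    rw [← (Fin.consEquiv fun _ => ι).tsum_eq, ENNReal.tsum_prod']
    simp only [Fin.consEquiv, Equiv.coe_fn_mk, Fin.sum_univ_succ, Fin.cons_zero, Fin.cons_succ]
    exact tsum_congr fun i => ih fun a => φ (e i + a)

/-- The Otter–Dwass formula. If a term of the family `F` splits into a term `e i` together with
`γ (e i)` further terms of `F`, then sums over `k`-tuples of `F` made of `n` pieces reduce to sums
over `n`-tuples of pieces. -/
theorem iterSum_otterDwass {F : κ → A} {e : ι → A} {γ : A →+ ℕ}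
    (h : ∀ φ : A → ℝ≥0∞, ∑' t, φ (F t) = ∑' i, iterSum F (γ (e i)) fun a => φ (e i + a))
    (n k : ℕ) {φ : A → ℝ≥0∞} (hφ : ∀ a, φ a ≠ 0 → γ a + k = n) :
    n * iterSum F k φ = k * iterSum e n φ := by
  induction n generalizing k φ with
  | zero =>
    by_cases h0 : φ 0 = 0
    · simp [iterSum, h0]
    · have := hφ 0 h0
      have hk : k = 0 := by omega
      simp [hk]
  | succ n ih =>
    cases k with
    | zero =>
      have h0 : φ 0 = 0 := by
        by_contra h0
        simpa using hφ 0 h0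
      simp [iterSum, h0]
    | succ k =>
      -- Open the first of the `k + 1` terms: its `γ (e i)` subterms join the other `k`.
      have hstep : iterSum F (k + 1) φ =
          ∑' i, iterSum F (γ (e i) + k) fun a => φ (e i + a) := by
        rw [iterSum_succ, h fun b => iterSum F k fun a => φ (b + a)]
        simp only [iterSum_add, add_assoc]
      have hsub : ∀ i a, φ (e i + a) ≠ 0 → γ a + (γ (e i) + k) = n := by
        intro i a hi
        have := hφ _ hi
        rw [map_add] at this
        omega
      have hn : (n : ℝ≥0∞) * iterSum F (k + 1) φ =
          ∑' i, γ (e i) * iterSum e n (fun a => φ (e i + a)) + k * iterSum e (n + 1) φ := by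
        rw [hstep, ← ENNReal.tsum_mul_left, iterSum_succ, ← ENNReal.tsum_mul_left,
          ← ENNReal.tsum_add]
        refine tsum_congr fun i => ?_
        rw [ih _ (hsub i)]
        push_cast
        ring
      have hw := iterSum_weight e γ n φ
      -- On the support of `φ` the weight `γ a + k` is the constant `n`; averaging over the position
      -- of the opened piece thus replaces `γ (e i)` by a constant.
      have hγ : iterSum e (n + 1) (fun a => γ a * φ a) + k * iterSum e (n + 1) φ =
          n * iterSum e (n + 1) φ := by
        rw [← iterSum_const_mul, ← iterSum_const_mul, ← iterSum_fun_add]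
        congr 1
        funext a
        by_cases ha : φ a = 0
        · simp [ha]
        · have : γ a + k = n := by
            have := hφ a ha
            omega
          rw [← add_mul, ← this]
          push_cast
          rfl
      -- The final identity is cancelled by `n`, so the case of a single piece needs a direct
      -- argument.
      rcases Nat.eq_zero_or_pos n with rfl | hpos
      · rw [hstep, iterSum_succ, ← ENNReal.tsum_mul_left, ← ENNReal.tsum_mul_left]
        refine tsum_congr fun i => ?_
        rcases Nat.eq_zero_or_pos (γ (e i) + k) with h0 | h0
        · have hk : k = 0 := by omega
          rw [h0, hk]
          rfl
        · have hz : ∀ a, φ (e i + a) = 0 := by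
            intro a
            by_contra hi
            have := hsub i a hi
            omega
          simp [hz, iterSum_fun_zero]
      · have hcancel : (n : ℝ≥0∞) * ((n + 1 : ℕ) * iterSum F (k + 1) φ) =
            n * ((k + 1 : ℕ) * iterSum e (n + 1) φ) := by
          calc (n : ℝ≥0∞) * ((n + 1 : ℕ) * iterSum F (k + 1) φ)
              = (n + 1 : ℕ) * (n * iterSum F (k + 1) φ) := by ring
            _ = iterSum e (n + 1) (fun a => γ a * φ a) + k * iterSum e (n + 1) φ
                  + n * (k * iterSum e (n + 1) φ) := by
                rw [hn, mul_add, ← hw]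
                push_cast
                ring
            _ = _ := by
                rw [hγ]
                push_cast
                ring
        exact (ENNReal.mul_right_inj (by exact_mod_cast hpos.ne') (by simp)).1 hcancel

theorem iterSum_congr_of_count {e : ι → A} (P : AddSubmonoid A) (χ : A →+ ℕ)
    (he : ∀ i, e i ∈ P) (hχ : ∀ i, χ (e i) = 1) (k : ℕ)
    {φ ψ : A → ℝ≥0∞} (h : ∀ a ∈ P, χ a = k → φ a = ψ a) : iterSum e k φ = iterSum e k ψ := by
  induction k generalizing φ ψ with
  | zero => exact h 0 P.zero_mem (map_zero χ)
  | succ k ih =>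
    refine tsum_congr fun i => ih fun a ha hk => h _ (P.add_mem (he i) ha) ?_
    rw [map_add, hχ, hk, add_comm]

theorem iterSum_equiv (E : κ ≃ ι) (e : ι → A) (k : ℕ) (φ : A → ℝ≥0∞) :
    iterSum (fun j => e (E j)) k φ = iterSum e k φ := by
  induction k generalizing φ with
  | zero => rfl
  | succ k ih =>
    simp only [iterSum, ih]
    exact E.tsum_eq fun i => iterSum e k fun a => φ (e i + a)

theorem iterSum_const_add (c : A) (e : ι → A) (k : ℕ) (φ : A → ℝ≥0∞) :
    iterSum (fun i => c + e i) k φ = iterSum e k fun a => φ (k • c + a) := by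
  induction k generalizing φ with
  | zero => simp [iterSum]
  | succ k ih =>
    simp only [iterSum, ih, succ_nsmul]
    simp only [add_assoc, add_left_comm]

theorem iterSum_unique [Unique ι] (e : ι → A) (k : ℕ) (φ : A → ℝ≥0∞) :
    iterSum e k φ = φ (k • e default) := by
  induction k generalizing φ with
  | zero => simp [iterSum]
  | succ k ih => simp [iterSum, ih, tsum_fintype, succ_nsmul, add_comm]

/-- The indicator of a proposition. -/
def indic (Q : Prop) : ℝ≥0∞ :=
  open Classical in if Q then 1 else 0

theorem indic_of_true {Q : Prop} (h : Q) : indic Q = 1 := if_pos h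

theorem indic_of_false {Q : Prop} (h : ¬Q) : indic Q = 0 := if_neg h

theorem indic_ne_zero {Q : Prop} : indic Q ≠ 0 ↔ Q := by
  by_cases h : Q <;> simp [indic, h]

theorem indic_and (Q R : Prop) : indic (Q ∧ R) = indic Q * indic R := by
  by_cases h : Q <;> by_cases h' : R <;> simp [indic, h, h']

theorem tsum_indic_and (Q : Prop) (x y : ℕ) :
    ∑' z : ℕ × ℕ, indic (Q ∧ x = z.1 ∧ y = z.2) = indic Q := by
  rw [tsum_eq_single (x, y)]
  · simp
  · rintro ⟨a, b⟩ h
    refine indic_of_false ?_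
    rintro ⟨-, rfl, rfl⟩
    exact h rfl

end IterSum

/-! ### Truncation, grafting and edge multisets of trees. -/

section Trees

theorem tsum_tree (f : BTree → ℝ≥0∞) :
    ∑' t, f t = f .nil + ∑' lr : BTree × BTree, f (.node () lr.1 lr.2) := by
  let E : Option (BTree × BTree) ≃ BTree :=
    { toFun := fun o => o.elim .nil fun lr => .node () lr.1 lr.2
      invFun := fun t => match t with
        | .nil => none
        | .node _ l r => some (l, r)
      left_inv := by rintro (_ | ⟨l, r⟩) <;> rfl
      right_inv := by rintro (_ | ⟨_, l, r⟩) <;> rfl }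
  rw [← E.tsum_eq, tsum_option_ennreal]
  rfl

theorem tsum_nonempty_tree (f : BTree → ℝ≥0∞) :
    ∑' t : {t : BTree // t ≠ .nil}, f t =
      ∑' lr : BTree × BTree, f (.node () lr.1 lr.2) := by
  have h := tsum_subtype {t : BTree | t ≠ .nil} f
  rw [tsum_tree] at h
  refine Eq.trans ?_ (h.trans (by simp [Set.indicator]))
  rfl

/-- The nonempty trees which, with root label `d`, have no strict descendants of vertices with
label `0`. -/
def truncated (d : ℤ) : Set BTree := {σ | σ ≠ .nil ∧ truncate d σ = σ}

theorem truncate_eq_nil {d : ℤ} {t : BTree} : truncate d t = .nil ↔ t = .nil := by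
  cases t with
  | nil => simp [truncate]
  | node a l r =>
    simp only [truncate]
    split_ifs <;> simp

theorem truncate_truncate (d : ℤ) (t : BTree) : truncate d (truncate d t) = truncate d t := by
  induction t generalizing d with
  | nil => rfl
  | node a l r ihl ihr =>
    by_cases h : d = 0
    · simp [truncate, h]
    · simp [truncate, h, ihl, ihr]

theorem truncate_mem_truncated {d : ℤ} {t : BTree} (ht : t ≠ .nil) :
    truncate d t ∈ truncated d :=
  ⟨fun h => ht (truncate_eq_nil.1 h), truncate_truncate d t⟩

theorem edgeTo_truncate (x y d : ℤ) (t : BTree) : edgeTo x y (truncate d t) = edgeTo x y t := by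
  cases t with
  | nil => rfl
  | node a l r =>
    simp only [truncate]
    split_ifs <;> rfl

/-- The edge multiset of a nonempty tree whose root has label `m`. -/
def rootedEdges (m : ℤ) (t : {t : BTree // t ≠ .nil}) : Multiset (ℤ × ℤ) := edges m t

/-- A tree with given truncation `σ` at level `m` arises by grafting a tree at every vertex of `σ`
with label `m`. -/
theorem tsum_truncate_fibre (m d : ℤ) {σ : BTree} (hσ : truncate d σ = σ)
    (φ : Multiset (ℤ × ℤ) → ℝ≥0∞) :
    ∑' t : BTree, (if truncate d t = σ then φ (edges (m + d) t) else 0) =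
      iterSum (rootedEdges m) ((labels (m + d) σ).count m) fun a => φ (edges (m + d) σ + a) := by
  induction σ generalizing d φ with
  | nil =>
    rw [tsum_tree]
    simp [truncate_eq_nil, labels, edges, iterSum]
  | node u l r ihl ihr =>
    rw [tsum_tree]
    by_cases h : d = 0
    · subst h
      simp only [truncate, if_true, BinaryTree.node.injEq, true_and] at hσ
      obtain ⟨rfl, rfl⟩ := hσ
      simp only [add_zero, labels, Multiset.cons_zero, Multiset.count_singleton_self, iterSum_one,
        rootedEdges, tsum_nonempty_tree fun t =>
          φ (edges m (.node u .nil .nil) + edges m t)]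
      simp [truncate, edges, edgeTo]
    · simp only [truncate, h, if_false, BinaryTree.node.injEq, true_and] at hσ
      have hx : m + d ≠ m := by omega
      have e1 : m + d - 1 = m + (d - 1) := by ring
      have e2 : m + d + 1 = m + (d + 1) := by ring
      have hcount : (labels (m + d) (.node u l r)).count m =
          (labels (m + (d - 1)) l).count m + (labels (m + (d + 1)) r).count m := by
        simp only [labels, Multiset.count_cons_of_ne hx.symm, Multiset.count_add, e1, e2]
      rw [hcount, iterSum_add, ENNReal.tsum_prod']
      have hr : ∀ l' : BTree, (∑' r' : BTree,
          if truncate d (.node () l' r') = .node u l r then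
            φ (edges (m + d) (.node () l' r')) else 0) =
          if truncate (d - 1) l' = l then
            iterSum (rootedEdges m) ((labels (m + (d + 1)) r).count m) (fun b =>
              φ (edgeTo (m + d) (m + (d - 1)) l + edgeTo (m + d) (m + (d + 1)) r +
                (edges (m + (d - 1)) l' + (edges (m + (d + 1)) r + b)))) else 0 := by
        intro l'
        by_cases hl : truncate (d - 1) l' = l
        · rw [if_pos hl, ← ihr (d + 1) hσ.2 fun b =>
            φ (edgeTo (m + d) (m + (d - 1)) l + edgeTo (m + d) (m + (d + 1)) r +
                (edges (m + (d - 1)) l' + b))]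
          refine tsum_congr fun r' => ?_
          by_cases hr : truncate (d + 1) r' = r
          · simp only [truncate, h, if_false, hl, hr, if_true, edges, e1, e2]
            rw [← hl, ← hr, edgeTo_truncate, edgeTo_truncate]
          · simp [truncate, h, hl, hr]
        · simp [truncate, h, hl]
      have hnil : truncate d .nil ≠ BinaryTree.node u l r := by simp [truncate]
      simp only [hr, if_neg hnil, zero_add]
      rw [ihl (d - 1) hσ.1 fun a =>
        iterSum (rootedEdges m) ((labels (m + (d + 1)) r).count m) (fun b =>
              φ (edgeTo (m + d) (m + (d - 1)) l + edgeTo (m + d) (m + (d + 1)) r +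
                (a + (edges (m + (d + 1)) r + b))))]
      simp only [edges, e1, e2, add_assoc, add_left_comm]

theorem tsum_truncate (m d : ℤ) (φ : Multiset (ℤ × ℤ) → ℝ≥0∞) :
    ∑' t : {t : BTree // t ≠ .nil}, φ (edges (m + d) t) =
      ∑' σ : truncated d, iterSum (rootedEdges m) ((labels (m + d) σ).count m)
        fun a => φ (edges (m + d) σ + a) := by
  simp only [fun σ : truncated d => (tsum_truncate_fibre m d σ.2.2 φ).symm]
  rw [ENNReal.tsum_comm, tsum_tree, tsum_nonempty_tree fun t => φ (edges (m + d) t)]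
  have h0 : ∀ σ : truncated d, truncate d .nil ≠ σ := fun σ h => σ.2.1 h.symm
  simp only [h0, if_false, tsum_zero, zero_add]
  refine tsum_congr fun lr => ?_
  rw [tsum_eq_single ⟨truncate d (.node () lr.1 lr.2), truncate_mem_truncated (by simp)⟩]
  · simp
  · intro σ hσ
    rw [if_neg]
    intro h
    exact hσ (Subtype.ext h.symm)

/-- Every vertex except the root is the endpoint of exactly one edge; counts of vertices thus become
additive counts of edges. -/
theorem labels_eq_cons {t : BTree} (ht : t ≠ .nil) (x : ℤ) :
    labels x t = x ::ₘ (edges x t).map Prod.snd := by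
  have h : ∀ (t : BTree) (x y : ℤ), labels y t = (edgeTo x y t + edges y t).map Prod.snd := by
    intro t
    induction t with
    | nil => simp [labels, edges, edgeTo]
    | node a l r ihl ihr =>
      intro x y
      rw [labels, ihl y, ihr y, edges]
      change _ = Multiset.map Prod.snd ({(x, y)} + _)
      simp only [Multiset.singleton_add, Multiset.map_cons, Multiset.map_add]
      congr 1
      ac_rfl
  cases t with
  | nil => exact absurd rfl ht
  | node a l r => simpa [edgeTo] using h (.node a l r) x x

theorem card_edges (x : ℤ) {t : BTree} (ht : t ≠ .nil) : (edges x t).card = numEdges t := by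
  have h : ∀ (t : BTree) (x : ℤ), (labels x t).card = t.numNodes := by
    intro t
    induction t with
    | nil => simp [labels, BinaryTree.numNodes]
    | node a l r ihl ihr =>
      intro x
      simp [labels, BinaryTree.numNodes, ihl, ihr]
  have := h t x
  rw [labels_eq_cons ht, Multiset.card_cons, Multiset.card_map] at this
  rw [numEdges]
  omega

theorem count_labels_add (x c y : ℤ) (t : BTree) :
    (labels (x + c) t).count (y + c) = (labels x t).count y := by
  induction t generalizing x with
  | nil => simp [labels]
  | node a l r ihl ihr =>
    have e1 : x + c - 1 = x - 1 + c := by ring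
    have e2 : x + c + 1 = x + 1 + c := by ring
    simp [labels, e1, e2, ihl, ihr, Multiset.count_cons]

/-- The number of edges ending at a vertex with label `m`. -/
def arrivals (m : ℤ) : Multiset (ℤ × ℤ) →+ ℕ := Multiset.countPAddMonoidHom fun e => e.2 = m

theorem arrivals_edges {m x : ℤ} (hx : x ≠ m) {t : BTree} (ht : t ≠ .nil) :
    arrivals m (edges x t) = (labels x t).count m := by
  rw [labels_eq_cons ht, Multiset.count_cons_of_ne hx.symm, Multiset.count_map, arrivals,
    Multiset.coe_countPAddMonoidHom, Multiset.countP_eq_card_filter]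
  simp only [eq_comm]

/-- The edges of a truncated tree hanging from a vertex with label `m`, its root having label
`m + d`, including the edge that leads to its root. -/
def hangingEdges (m d : ℤ) (σ : truncated d) : Multiset (ℤ × ℤ) :=
  {(m, m + d)} + edges (m + d) σ

/-- The edge to the root of the subtree joins its truncated piece. As `d ≠ 0` it does not arrive at
`m`, so arrivals still count the grafting points. -/
theorem tsum_hanging (m : ℤ) {d : ℤ} (hd : d ≠ 0) (φ : Multiset (ℤ × ℤ) → ℝ≥0∞) :
    ∑' t : BTree, φ (edgeTo m (m + d) t + edges (m + d) t) =
      ∑' o : Option (truncated d), iterSum (rootedEdges m)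
        (arrivals m (o.elim 0 (hangingEdges m d))) fun a => φ (o.elim 0 (hangingEdges m d) + a) := by
  rw [tsum_tree, tsum_option_ennreal,
    ← tsum_nonempty_tree fun t => φ (edgeTo m (m + d) t + edges (m + d) t)]
  refine congrArg₂ (· + ·) ?_ ?_
  · simp [edgeTo, edges, iterSum]
  · have h : ∀ t : {t : BTree // t ≠ .nil}, edgeTo m (m + d) t = {(m, m + d)} := by
      rintro ⟨_ | _, ht⟩
      · exact absurd rfl ht
      · rfl
    simp only [h, Option.elim_some]
    rw [tsum_truncate m d fun a => φ ({(m, m + d)} + a)]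
    refine tsum_congr fun σ => ?_
    have hc : arrivals m (hangingEdges m d σ) = (labels (m + d) σ).count m := by
      rw [hangingEdges, map_add, arrivals_edges (by omega) σ.2.1, arrivals,
        Multiset.coe_countPAddMonoidHom, add_eq_right, Multiset.countP_eq_zero]
      simpa using hd
    rw [hc]
    simp only [hangingEdges, add_assoc]

/-- A tree with root label `m` splits into the part around its root that avoids the other vertices
with label `m`, and the trees hanging below it from vertices with label `m`. -/
theorem tsum_rootedEdges (m : ℤ) (φ : Multiset (ℤ × ℤ) → ℝ≥0∞) :
    ∑' t, φ (rootedEdges m t) = ∑' i : Option (truncated (-1)) × Option (truncated 1),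
      iterSum (rootedEdges m)
        (arrivals m (i.1.elim 0 (hangingEdges m (-1)) + i.2.elim 0 (hangingEdges m 1)))
        fun a => φ (i.1.elim 0 (hangingEdges m (-1)) + i.2.elim 0 (hangingEdges m 1) + a) := by
  simp only [rootedEdges]
  rw [tsum_nonempty_tree fun t => φ (edges m t), ENNReal.tsum_prod', ENNReal.tsum_prod']
  have h : ∀ l r : BTree, edges m (.node () l r) =
      edgeTo m (m + -1) l + edges (m + -1) l + (edgeTo m (m + 1) r + edges (m + 1) r) := by
    intro l r
    rw [edges, ← sub_eq_add_neg]
    abel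
  simp only [h]
  simp only [fun l : BTree => tsum_hanging m one_ne_zero fun b =>
    φ (edgeTo m (m + -1) l + edges (m + -1) l + b)]
  rw [tsum_hanging m (d := -1) (by norm_num) fun a => ∑' o : Option (truncated 1),
    iterSum (rootedEdges m) (arrivals m (o.elim 0 (hangingEdges m 1)))
      fun b => φ (a + (o.elim 0 (hangingEdges m 1) + b))]
  simp only [iterSum_fun_tsum, map_add, iterSum_add, add_assoc, add_left_comm]

theorem edges_adjacent {x : ℤ} {t : BTree} :
    ∀ e ∈ edges x t, e.2 = e.1 - 1 ∨ e.2 = e.1 + 1 := by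
  have h : ∀ (x y : ℤ) (t : BTree), ∀ e ∈ edgeTo x y t, e = (x, y) := by
    intro x y t
    cases t <;> simp [edgeTo]
  induction t generalizing x with
  | nil => simp [edges]
  | node a l r ihl ihr =>
    intro e he
    simp only [edges, Multiset.mem_add] at he
    rcases he with (he | he) | he | he
    · left; rw [h _ _ _ e he]
    · right; rw [h _ _ _ e he]
    · exact ihl e he
    · exact ihr e he

theorem mem_edgeTo {x y : ℤ} {t : BTree} {e : ℤ × ℤ} :
    e ∈ edgeTo x y t ↔ t ≠ .nil ∧ e = (x, y) := by
  cases t <;> simp [edgeTo]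

/-- Vertices of label `m` are leaves, so no path from below crosses `m`. The strict inequality makes
the edge leading to a hanging piece the only one of its kind in that piece. -/
theorem edges_lt_of_truncate_eq (m : ℤ) {d : ℤ} {t : BTree} (hd : d ≤ 0) (ht : truncate d t = t) :
    ∀ e ∈ edges (m + d) t, e.1 < m ∧ e.2 ≤ m := by
  induction t generalizing d with
  | nil => simp [edges]
  | node a l r ihl ihr =>
    intro e he
    by_cases h : d = 0
    · simp only [truncate, h, if_true, BinaryTree.node.injEq, true_and] at ht
      simp [← ht.1, ← ht.2, edges, edgeTo] at he
    · simp only [truncate, h, if_false, BinaryTree.node.injEq, true_and] at ht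
      have e1 : m + d - 1 = m + (d - 1) := by ring
      have e2 : m + d + 1 = m + (d + 1) := by ring
      simp only [edges, Multiset.mem_add, mem_edgeTo, e1, e2] at he
      rcases he with (⟨-, rfl⟩ | ⟨-, rfl⟩) | he | he
      · constructor <;> dsimp only <;> omega
      · constructor <;> dsimp only <;> omega
      · exact ihl (by omega) ht.1 e he
      · exact ihr (by omega) ht.2 e he

theorem lt_edges_of_truncate_eq (m : ℤ) {d : ℤ} {t : BTree} (hd : 0 ≤ d) (ht : truncate d t = t) :
    ∀ e ∈ edges (m + d) t, m < e.1 ∧ m ≤ e.2 := by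
  induction t generalizing d with
  | nil => simp [edges]
  | node a l r ihl ihr =>
    intro e he
    by_cases h : d = 0
    · simp only [truncate, h, if_true, BinaryTree.node.injEq, true_and] at ht
      simp [← ht.1, ← ht.2, edges, edgeTo] at he
    · simp only [truncate, h, if_false, BinaryTree.node.injEq, true_and] at ht
      have e1 : m + d - 1 = m + (d - 1) := by ring
      have e2 : m + d + 1 = m + (d + 1) := by ring
      simp only [edges, Multiset.mem_add, mem_edgeTo, e1, e2] at he
      rcases he with (⟨-, rfl⟩ | ⟨-, rfl⟩) | he | he
      · constructor <;> dsimp only <;> omega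
      · constructor <;> dsimp only <;> omega
      · exact ihl (by omega) ht.1 e he
      · exact ihr (by omega) ht.2 e he

theorem truncate_eq_of_edges (m : ℤ) {d : ℤ} {t : BTree}
    (h : ∀ e ∈ edges (m + d) t, e.1 ≠ m) : truncate d t = t := by
  induction t generalizing d with
  | nil => rfl
  | node a l r ihl ihr =>
    have e1 : m + d - 1 = m + (d - 1) := by ring
    have e2 : m + d + 1 = m + (d + 1) := by ring
    simp only [edges, Multiset.mem_add, mem_edgeTo, e1, e2] at h
    by_cases hd : d = 0
    · have hl : l = .nil := by
        by_contra hl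
        exact h _ (Or.inl (Or.inl ⟨hl, rfl⟩)) (by simp [hd])
      have hr : r = .nil := by
        by_contra hr
        exact h _ (Or.inl (Or.inr ⟨hr, rfl⟩)) (by simp [hd])
      simp [truncate, hd, hl, hr]
    · simp only [truncate, hd, if_false]
      rw [ihl fun e he => h e (Or.inr (Or.inl he)), ihr fun e he => h e (Or.inr (Or.inr he))]

end Trees

/-! ### Counting forests cut at level `m`. -/

section NodeCount

/-- The multisets of adjacent pairs of integers all of which satisfy `P`. -/
def adjacentPairs (P : ℤ × ℤ → Prop) : AddSubmonoid (Multiset (ℤ × ℤ)) where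
  carrier := {a | ∀ e ∈ a, P e ∧ (e.2 = e.1 - 1 ∨ e.2 = e.1 + 1)}
  zero_mem' := by simp
  add_mem' := by
    intro a b ha hb e he
    rcases Multiset.mem_add.1 he with he | he
    · exact ha e he
    · exact hb e he

theorem mem_adjacentPairs {P : ℤ × ℤ → Prop} {a : Multiset (ℤ × ℤ)} :
    a ∈ adjacentPairs P ↔ ∀ e ∈ a, P e ∧ (e.2 = e.1 - 1 ∨ e.2 = e.1 + 1) := Iff.rfl

theorem add_mem_adjacentPairs {P : ℤ × ℤ → Prop} {a b : Multiset (ℤ × ℤ)} :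
    a + b ∈ adjacentPairs P ↔ a ∈ adjacentPairs P ∧ b ∈ adjacentPairs P := by
  simp only [mem_adjacentPairs, Multiset.mem_add, or_imp, forall_and]
  tauto

/-- Multisets of edges with no label above `m`. -/
abbrev lowEdges (m : ℤ) := adjacentPairs fun e => e.1 ≤ m ∧ e.2 ≤ m

/-- Multisets of edges with no label below `m`. -/
abbrev highEdges (m : ℤ) := adjacentPairs fun e => m ≤ e.1 ∧ m ≤ e.2

theorem edges_mem_adjacentPairs (x : ℤ) (t : BTree) :
    edges x t ∈ adjacentPairs fun _ => True := fun e he => ⟨trivial, edges_adjacent e he⟩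

theorem adjacentPairs_le_true {P : ℤ × ℤ → Prop} {a : Multiset (ℤ × ℤ)} (ha : a ∈ adjacentPairs P) :
    a ∈ adjacentPairs fun _ => True := fun e he => ⟨trivial, (ha e he).2⟩

theorem hangingEdges_mem_low (m : ℤ) (σ : truncated (-1)) :
    hangingEdges m (-1) σ ∈ lowEdges m := by
  intro e he
  rcases Multiset.mem_add.1 he with he | he
  · rw [Multiset.mem_singleton] at he
    subst he
    dsimp only
    omega
  · have := edges_lt_of_truncate_eq m (by norm_num) σ.2.2 e he
    exact ⟨⟨this.1.le, this.2⟩, edges_adjacent e he⟩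

theorem hangingEdges_mem_high (m : ℤ) (σ : truncated 1) :
    hangingEdges m 1 σ ∈ highEdges m := by
  intro e he
  rcases Multiset.mem_add.1 he with he | he
  · rw [Multiset.mem_singleton] at he
    subst he
    dsimp only
    omega
  · have := lt_edges_of_truncate_eq m (by norm_num) σ.2.2 e he
    exact ⟨⟨this.1.le, this.2⟩, edges_adjacent e he⟩

theorem elim_hangingEdges_mem {P : ℤ × ℤ → Prop} {m d : ℤ}
    (h : ∀ σ, hangingEdges m d σ ∈ adjacentPairs P) (o : Option (truncated d)) :
    o.elim 0 (hangingEdges m d) ∈ adjacentPairs P := by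
  cases o with
  | none => exact AddSubmonoid.zero_mem _
  | some σ => exact h σ

theorem count_hangingEdges_low (m : ℤ) (σ : truncated (-1)) :
    (hangingEdges m (-1) σ).count (m, m - 1) = 1 := by
  rw [hangingEdges, Multiset.count_add, ← sub_eq_add_neg, Multiset.count_singleton_self,
    Multiset.count_eq_zero.2]
  intro he
  rw [sub_eq_add_neg m] at he
  exact lt_irrefl _ (edges_lt_of_truncate_eq m (by norm_num) σ.2.2 _ he).1

theorem count_hangingEdges_high (m : ℤ) (σ : truncated 1) :
    (hangingEdges m 1 σ).count (m, m + 1) = 1 := by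
  rw [hangingEdges, Multiset.count_add, Multiset.count_singleton_self,
    Multiset.count_eq_zero.2]
  intro he
  exact lt_irrefl _ (lt_edges_of_truncate_eq m (by norm_num) σ.2.2 _ he).1

theorem count_eq_zero_of_low {m : ℤ} {a : Multiset (ℤ × ℤ)} (ha : a ∈ lowEdges m)
    {e : ℤ × ℤ} (he : m < e.1 ∨ m < e.2) : a.count e = 0 := by
  rw [Multiset.count_eq_zero]
  intro h
  have := (ha e h).1
  omega

theorem count_eq_zero_of_high {m : ℤ} {a : Multiset (ℤ × ℤ)} (ha : a ∈ highEdges m)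
    {e : ℤ × ℤ} (he : e.1 < m ∨ e.2 < m) : a.count e = 0 := by
  rw [Multiset.count_eq_zero]
  intro h
  have := (ha e h).1
  omega

theorem arrivals_eq (m : ℤ) {a : Multiset (ℤ × ℤ)} (ha : a ∈ adjacentPairs fun _ => True) :
    arrivals m a = a.count (m - 1, m) + a.count (m + 1, m) := by
  induction a using Multiset.induction_on with
  | empty => simp
  | cons e a ih =>
    have he := (ha e (Multiset.mem_cons_self e a)).2
    have := ih fun e' he' => ha e' (Multiset.mem_cons_of_mem he')
    rw [arrivals, Multiset.coe_countPAddMonoidHom] at this ⊢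
    rw [Multiset.countP_cons, Multiset.count_cons, Multiset.count_cons, this]
    obtain ⟨x, y⟩ := e
    simp only [Prod.mk.injEq] at he ⊢
    split_ifs <;> omega

/-- Counting forests of trees with root label `m` by the numbers `N` of vertices with label `m`,
`q` of left and `r` of right children of these. -/
theorem iterSum_rootedEdges (m : ℤ) (N k q r : ℕ) {ψ : Multiset (ℤ × ℤ) → ℝ≥0∞}
    (hψ : ∀ a ∈ adjacentPairs fun _ => True, ψ a ≠ 0 →
      arrivals m a + k = N ∧ a.count (m, m - 1) = q ∧ a.count (m, m + 1) = r) :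
    N * iterSum (rootedEdges m) k ψ =
      k * (N.choose q * (N.choose r * iterSum (hangingEdges m (-1)) q fun a =>
        iterSum (hangingEdges m 1) r fun b => ψ (a + b))) := by
  -- The hypothesis on `ψ` concerns adjacent pairs only, whereas Otter–Dwass needs it everywhere;
  -- multiplying by an indicator changes nothing on edge multisets of trees.
  set ψ' : Multiset (ℤ × ℤ) → ℝ≥0∞ := fun a => indic (a ∈ adjacentPairs fun _ => True) * ψ a
    with hψ'
  have heq : ∀ a ∈ adjacentPairs fun _ => True, ψ a = ψ' a := by
    intro a ha
    simp only [hψ', indic_of_true ha, one_mul]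
  have hsub : ∀ a, ψ' a ≠ 0 →
      arrivals m a + k = N ∧ a.count (m, m - 1) = q ∧ a.count (m, m + 1) = r := by
    intro a ha
    have h := mul_ne_zero_iff.1 ha
    exact hψ a (indic_ne_zero.1 h.1) h.2
  rw [iterSum_congr_of_mem (e := rootedEdges m) (adjacentPairs fun _ => True)
      (fun t => edges_mem_adjacentPairs m t.1) k heq,
    iterSum_otterDwass (tsum_rootedEdges m) N k fun a ha => (hsub a ha).1,
    iterSum_prod (fun o : Option (truncated (-1)) => o.elim 0 (hangingEdges m (-1)))
      (fun o : Option (truncated 1) => o.elim 0 (hangingEdges m 1))]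
  congr 1
  have hinner : ∀ a ∈ lowEdges m,
      (iterSum (fun o : Option (truncated 1) => o.elim 0 (hangingEdges m 1)) N
        fun b => ψ' (a + b)) =
      N.choose r * iterSum (hangingEdges m 1) r fun b => ψ' (a + b) := by
    intro a ha
    refine iterSum_option (Multiset.countAddMonoidHom (m, m + 1)) ?_ N r ?_
    · exact count_hangingEdges_high m
    · intro b hb
      have := (hsub _ hb).2.2
      rwa [Multiset.count_add, count_eq_zero_of_low ha (Or.inr (by simp)), zero_add] at this
  rw [iterSum_congr_of_mem (lowEdges m) (elim_hangingEdges_mem (hangingEdges_mem_low m)) N hinner,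
    iterSum_option (Multiset.countAddMonoidHom (m, m - 1)) (count_hangingEdges_low m) N q,
    iterSum_const_mul]
  · congr 2
    refine iterSum_congr_of_mem (lowEdges m) (hangingEdges_mem_low m) q fun a ha =>
      iterSum_congr_of_mem (highEdges m) (hangingEdges_mem_high m) r fun b hb => ?_
    exact (heq _ (AddSubmonoid.add_mem _ (adjacentPairs_le_true ha)
      (adjacentPairs_le_true hb))).symm
  · intro a ha
    by_contra hne
    refine ha ?_
    rw [iterSum_congr_of_mem (ψ := fun _ => 0) (highEdges m) (hangingEdges_mem_high m) r,
      iterSum_fun_zero, mul_zero]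
    intro b hb
    by_contra h
    have := (hsub _ h).2.1
    rw [Multiset.count_add, count_eq_zero_of_high hb (Or.inr (by simp)), add_zero] at this
    exact hne this

end NodeCount

/-! ### Excursions above a level and their own decomposition. -/

section Excursions

/-- The number of `p`-tuples of excursions with `q` vertices with label `0` and `V - v` edges,
counting for each excursion also an edge that leads to its root. -/
def excursionCount (V p q v : ℕ) : ℝ≥0∞ :=
  iterSum (fun τ : truncated 1 => (zeroCount τ, numEdges τ + 1)) p
    fun x => indic (x.1 = q ∧ x.2 + v = V)

theorem arrivals_hangingEdges (m : ℤ) (τ : truncated 1) :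
    arrivals m (hangingEdges m 1 τ) = zeroCount τ := by
  have h := count_labels_add 1 m 0 τ.1
  rw [zero_add, add_comm 1 m] at h
  rw [hangingEdges, map_add, arrivals_edges (by omega) τ.2.1, h, zeroCount, arrivals,
    Multiset.coe_countPAddMonoidHom, add_eq_right, Multiset.countP_eq_zero]
  simp

theorem card_hangingEdges (m d : ℤ) (τ : truncated d) :
    (hangingEdges m d τ).card = numEdges τ + 1 := by
  rw [hangingEdges, Multiset.card_add, card_edges _ τ.2.1, Multiset.card_singleton, add_comm]

/-- Translation invariance: the level `m` from which the excursions hang is immaterial. -/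
theorem iterSum_hangingEdges (m : ℤ) (V p q v : ℕ) :
    (iterSum (hangingEdges m 1) p fun b => indic (arrivals m b = q ∧ b.card + v = V)) =
      excursionCount V p q v := by
  rw [excursionCount]
  have h := iterSum_comp (hangingEdges m 1) ((arrivals m).prod Multiset.cardHom) p
    fun x => indic (x.1 = q ∧ x.2 + v = V)
  simpa [arrivals_hangingEdges, card_hangingEdges] using h

/-- Excursions are the trees with root label 1 in which no edge starts below label 1. The summand
`p` accounts for the edges leading to their roots. -/
theorem excursionCount_eq_iterSum_rootedEdges (V p q v : ℕ) :
    excursionCount V p q v = iterSum (rootedEdges 1) p fun a =>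
      indic (a ∈ adjacentPairs (fun e => 1 ≤ e.1) ∧ a.count (1, 0) = q ∧ a.card + p + v = V) := by
  rw [← iterSum_hangingEdges 0]
  have h1 := iterSum_const_add {((0 : ℤ), (0 : ℤ) + 1)}
    (fun τ : truncated 1 => edges ((0 : ℤ) + 1) τ) p
    fun b => indic (arrivals 0 b = q ∧ b.card + v = V)
  change iterSum (hangingEdges 0 1) p _ = _ at h1
  rw [h1, iterSum_subtype (rootedEdges 1) (adjacentPairs fun e => 1 ≤ e.1)
    (fun a b h => add_mem_adjacentPairs.1 h) p fun a h => (indic_ne_zero.1 h).1]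
  let E : {t : {t : BTree // t ≠ .nil} // rootedEdges 1 t ∈ adjacentPairs fun e => 1 ≤ e.1} ≃
      truncated 1 :=
    { toFun := fun t => ⟨t.1.1, t.1.2, truncate_eq_of_edges 0 fun e he => by
        have := (t.2 e (by simpa [rootedEdges] using he)).1
        omega⟩
      invFun := fun τ => ⟨⟨τ.1, τ.2.1⟩, fun e he => by
        have := lt_edges_of_truncate_eq 0 (by norm_num) τ.2.2 e (by simpa [rootedEdges] using he)
        exact ⟨by omega, edges_adjacent e he⟩⟩
      left_inv := fun _ => rfl
      right_inv := fun _ => rfl }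
  rw [← iterSum_equiv E]
  refine iterSum_congr_of_mem (adjacentPairs fun e => 1 ≤ e.1) (fun t => t.2) p fun a ha => ?_
  congr 1
  have h0 : a.count (-1, 0) = 0 := by
    rw [Multiset.count_eq_zero]
    intro h
    have := (ha _ h).1
    norm_num at this
  have h2 : arrivals 0 {((0 : ℤ), (1 : ℤ))} = 0 := by
    rw [arrivals, Multiset.coe_countPAddMonoidHom, Multiset.countP_eq_zero]
    simp
  simp only [zero_add, map_add, map_nsmul, h2, mul_zero, arrivals_eq 0 (adjacentPairs_le_true ha),
    zero_sub, h0, Multiset.card_add, Multiset.card_nsmul, Multiset.card_singleton, ha, true_and,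
    smul_eq_mul, mul_one, add_comm p]

/-- Below level 1 an excursion has only leaves of label 0, so its lower pieces are all equal and
contribute no further choice. -/
theorem truncated_neg_one_eq {σ : truncated (-1)}
    (h : hangingEdges 1 (-1) σ ∈ adjacentPairs fun e => 1 ≤ e.1) :
    σ.1 = .node () .nil .nil := by
  obtain ⟨σ, hσ⟩ := σ
  have h' := (add_mem_adjacentPairs.1 h).2
  cases σ with
  | nil => exact absurd rfl hσ.1
  | node a l r =>
    have key : ∀ e, e ∉ edges (1 + -1) (.node a l r) := by
      intro e he
      have h1 := (h' e he).1
      have h2 := edges_lt_of_truncate_eq 1 (by norm_num) hσ.2 e he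
      omega
    simp only [edges, Multiset.mem_add, mem_edgeTo, not_or, not_and] at key
    have hl : l = .nil := by
      by_contra hl
      exact (key (_, _)).1.1 hl rfl
    have hr : r = .nil := by
      by_contra hr
      exact (key (_, _)).1.2 hr rfl
    subst hl hr
    rfl

/-- The decomposition of excursions at their vertices with label `1`. -/
theorem excursionCount_eq_tsum (V p q v : ℕ) :
    ∃ B : ℕ × ℕ → ℝ≥0∞, excursionCount V p q v = ∑' z, B z ∧
      ∀ r s, ((p + s : ℕ) : ℝ≥0∞) * B (r, s) =
        p * ((p + s).choose q * ((p + s).choose r * excursionCount V r s (v + p + q))) := by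
  refine ⟨fun z => iterSum (rootedEdges 1) p fun a =>
    indic ((a ∈ adjacentPairs (fun e => 1 ≤ e.1) ∧ a.count (1, 0) = q ∧ a.card + p + v = V) ∧
      a.count (1, 2) = z.1 ∧ a.count (2, 1) = z.2), ?_, ?_⟩
  · rw [excursionCount_eq_iterSum_rootedEdges, ← iterSum_fun_tsum]
    simp only [tsum_indic_and]
  · intro r s
    rw [iterSum_rootedEdges 1 (p + s) p q r]
    · congr 3
      rw [iterSum_subtype (hangingEdges 1 (-1)) (adjacentPairs fun e => 1 ≤ e.1)
        (fun a b h => add_mem_adjacentPairs.1 h)]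
      · let U : Unique {σ : truncated (-1) // hangingEdges 1 (-1) σ ∈
            adjacentPairs fun e => 1 ≤ e.1} :=
          { default := ⟨⟨.node () .nil .nil, by simp, by simp [truncate]⟩, by
              intro e he
              simp only [hangingEdges, edges, edgeTo, add_zero, Multiset.mem_singleton] at he
              subst he
              norm_num⟩
            uniq := fun σ => Subtype.ext (Subtype.ext (truncated_neg_one_eq σ.2)) }
        rw [iterSum_unique]
        have hd : hangingEdges 1 (-1) (default : {σ : truncated (-1) // hangingEdges 1 (-1) σ ∈
            adjacentPairs fun e => 1 ≤ e.1}).1 = {((1 : ℤ), (0 : ℤ))} := by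
          change {((1 : ℤ), (1 : ℤ) + -1)} + edges _ (.node () .nil .nil) = _
          simp [edges, edgeTo]
        rw [hd, ← iterSum_hangingEdges 1]
        refine iterSum_congr_of_count (highEdges 1) (Multiset.countAddMonoidHom (1, 1 + 1))
          (hangingEdges_mem_high 1) (count_hangingEdges_high 1) r fun b hb hbr => ?_
        have hbr' : b.count (1, 2) = r := hbr
        congr 1
        have hmem : q • {((1 : ℤ), (0 : ℤ))} + b ∈ adjacentPairs fun e => 1 ≤ e.1 := by
          refine AddSubmonoid.add_mem _ (AddSubmonoid.nsmul_mem _ ?_ q) fun e he =>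
            ⟨(hb e he).1.1, (hb e he).2⟩
          intro e he
          rw [Multiset.mem_singleton] at he
          subst he
          norm_num
        have c1 : b.count (1, 0) = 0 := count_eq_zero_of_high hb (by norm_num)
        have c2 : b.count (0, 1) = 0 := count_eq_zero_of_high hb (by norm_num)
        have ha : arrivals 1 b = b.count (2, 1) := by
          rw [arrivals_eq 1 (adjacentPairs_le_true hb)]
          norm_num [c2]
        simp only [hmem, Multiset.count_add, Multiset.count_nsmul, c1, hbr', ha, true_and,
          Multiset.card_add, Multiset.card_nsmul, Multiset.card_singleton,
          Multiset.count_singleton, Prod.mk.injEq]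
        norm_num
        constructor
        · rintro ⟨h, h'⟩
          exact ⟨h', by omega⟩
        · rintro ⟨h, h'⟩
          exact ⟨by omega, h⟩
      · intro a ha
        by_contra hn
        refine ha ?_
        rw [← iterSum_fun_zero (hangingEdges 1 1) r]
        congr 1
        funext b
        refine indic_of_false fun h => hn (add_mem_adjacentPairs.1 h.1.1).1
    · intro a ha h
      obtain ⟨⟨h1, h2, h3⟩, h4, h5⟩ := indic_ne_zero.1 h
      have h0 : a.count (0, 1) = 0 := by
        rw [Multiset.count_eq_zero]
        intro h
        have := (h1 _ h).1
        norm_num at this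
      rw [arrivals_eq 1 ha]
      norm_num [h0]
      dsimp only at h4 h5
      omega

end Excursions

/-! ### Factorisation of the number of trees with a given past. -/

section TreeCount

/-- The number of trees with root label `0` and `V` edges whose edge multiset satisfies `Q`. -/
def treeCount (V : ℕ) (Q : Multiset (ℤ × ℤ) → Prop) : ℝ≥0∞ :=
  ∑' t : {t : BTree // t ≠ .nil}, indic ((edges 0 t).card = V ∧ Q (edges 0 t))

/-- The weighted number of configurations below level `m` that satisfy `L`, made of a truncated
tree with root label `0` and `q` truncated trees hanging from vertices with label `m`. -/
def lowerWeight (m : ℤ) (q : ℕ) (L : Multiset (ℤ × ℤ) → Prop) : ℝ≥0∞ :=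
  ∑' σ : truncated (-m), arrivals m (edges 0 σ) *
    iterSum (hangingEdges m (-1)) q fun a => indic (L (edges 0 σ + a))

/-- The truncation `σ` at level `m` has `arrivals m (edges 0 σ)` leaves of label `m`, the roots of a
forest with `p + s` vertices of label `m`. Only `σ` and the lower pieces matter for `L`. The upper
pieces alone determine `s`, and by `hw` they must contain the remaining `V - w` edges. So the sum
over pieces is a product. -/
theorem treeCount_mul {m : ℤ} (hm : 0 < m) {L : Multiset (ℤ × ℤ) → Prop} {p q w : ℕ}
    (hL : ∀ a, ∀ b ∈ highEdges m, L (a + b) ↔ L a) (hp : ∀ a, L a → a.count (m - 1, m) = p)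
    (hq : ∀ a, L a → a.count (m, m - 1) = q) (hw : ∀ a ∈ lowEdges m, L a → a.card = w)
    (V r s : ℕ) :
    ((p + s : ℕ) : ℝ≥0∞) *
        treeCount V (fun a => L a ∧ a.count (m, m + 1) = r ∧ a.count (m + 1, m) = s) =
      (p + s).choose q * ((p + s).choose r *
        (lowerWeight m q L * excursionCount V r s w)) := by
  have hE : ∀ σ : truncated (-m), ∀ e ∈ edges 0 σ, e.1 < m ∧ e.2 ≤ m := fun σ e he =>
    edges_lt_of_truncate_eq m (d := -m) (by omega) σ.2.2 e (by rwa [add_neg_cancel])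
  have hlow : ∀ σ : truncated (-m), edges 0 σ ∈ lowEdges m := fun σ e he =>
    ⟨⟨(hE σ e he).1.le, (hE σ e he).2⟩, edges_adjacent e he⟩
  set φ : Multiset (ℤ × ℤ) → ℝ≥0∞ := fun a =>
    indic (a.card = V ∧ L a ∧ a.count (m, m + 1) = r ∧ a.count (m + 1, m) = s) with hφ
  have hsum := tsum_truncate m (-m) φ
  rw [add_neg_cancel] at hsum
  have hc : ∀ σ : truncated (-m), (labels 0 σ).count m = arrivals m (edges 0 σ) := fun σ =>
    (arrivals_edges hm.ne σ.2.1).symm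
  change _ * ∑' t : {t : BTree // t ≠ .nil}, φ (edges 0 t) = _
  rw [hsum, lowerWeight, ← ENNReal.tsum_mul_right, ← ENNReal.tsum_mul_left,
    ← ENNReal.tsum_mul_left, ← ENNReal.tsum_mul_left]
  refine tsum_congr fun σ => ?_
  rw [hc, iterSum_rootedEdges m (p + s) _ q r]
  · have key : (iterSum (hangingEdges m (-1)) q fun a =>
        iterSum (hangingEdges m 1) r fun b => φ (edges 0 σ + (a + b))) =
        (iterSum (hangingEdges m (-1)) q fun a => indic (L (edges 0 σ + a))) *
          excursionCount V r s w := by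
      rw [← iterSum_hangingEdges m, ← iterSum_mul_const]
      refine iterSum_congr_of_mem (lowEdges m) (hangingEdges_mem_low m) q fun a ha => ?_
      rw [← iterSum_const_mul]
      refine iterSum_congr_of_count (highEdges m) (Multiset.countAddMonoidHom (m, m + 1))
        (hangingEdges_mem_high m) (count_hangingEdges_high m) r fun b hb hbr => ?_
      have hbr' : b.count (m, m + 1) = r := hbr
      have hmem : edges 0 σ + a ∈ lowEdges m := AddSubmonoid.add_mem _ (hlow σ) ha
      have c1 : (edges 0 σ + a).count (m, m + 1) = 0 :=
        count_eq_zero_of_low hmem (Or.inr (by simp))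
      have c2 : (edges 0 σ + a).count (m + 1, m) = 0 :=
        count_eq_zero_of_low hmem (Or.inl (by simp))
      have hb' : arrivals m b = b.count (m + 1, m) := by
        rw [arrivals_eq m (adjacentPairs_le_true hb),
          count_eq_zero_of_high hb (Or.inl (by simp)), zero_add]
      rw [hφ, ← indic_and]
      dsimp only
      congr 1
      rw [← add_assoc, hL _ b hb, Multiset.count_add, c1, zero_add, Multiset.count_add, c2,
        zero_add, Multiset.card_add, hb', hbr']
      refine propext ⟨fun h => ⟨h.2.1, h.2.2.2, ?_⟩, fun h => ⟨?_, h.1, rfl, h.2.1⟩⟩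
      · rw [hw _ hmem h.2.1] at h
        omega
      · rw [hw _ hmem h.1]
        omega
    rw [key]
    ring
  · intro a ha h
    obtain ⟨-, h1, h2, h3⟩ := indic_ne_zero.1 h
    have h4 := hp _ h1
    have h5 := hq _ h1
    have hadj : edges 0 σ + a ∈ adjacentPairs fun _ => True :=
      AddSubmonoid.add_mem _ (adjacentPairs_le_true (hlow σ)) ha
    have h6 := arrivals_eq m hadj
    have c1 : (edges 0 σ : Multiset (ℤ × ℤ)).count (m, m - 1) = 0 := by
      rw [Multiset.count_eq_zero]
      exact fun h => lt_irrefl _ (hE σ _ h).1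
    have c2 : (edges 0 σ : Multiset (ℤ × ℤ)).count (m, m + 1) = 0 := by
      rw [Multiset.count_eq_zero]
      exact fun h => lt_irrefl _ (hE σ _ h).1
    rw [map_add] at h6
    rw [Multiset.count_add, c1] at h5
    have h2' := h2
    rw [Multiset.count_add, c2] at h2'
    omega

theorem treeCount_eq_tsum (V : ℕ) (L : Multiset (ℤ × ℤ) → Prop)
    (f g : Multiset (ℤ × ℤ) → ℕ) :
    treeCount V L = ∑' z : ℕ × ℕ, treeCount V fun a => L a ∧ f a = z.1 ∧ g a = z.2 := by
  simp only [treeCount]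
  rw [ENNReal.tsum_comm]
  refine tsum_congr fun t => ?_
  rw [← tsum_indic_and _ (f (edges 0 t)) (g (edges 0 t))]
  simp only [and_assoc]

/-- For each `(r, s)`, trees and `p`-tuples of excursions have the same binomials and the same
`excursionCount V r s`; these need not be evaluated when summing. -/
theorem treeCount_mul_eq {m : ℤ} (hm : 0 < m) {L : Multiset (ℤ × ℤ) → Prop} {p q v : ℕ}
    (hp0 : 0 < p)
    (hL : ∀ a, ∀ b ∈ highEdges m, L (a + b) ↔ L a) (hp : ∀ a, L a → a.count (m - 1, m) = p)
    (hq : ∀ a, L a → a.count (m, m - 1) = q)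
    (hw : ∀ a ∈ lowEdges m, L a → a.card = v + p + q) (V : ℕ) :
    p * treeCount V L = lowerWeight m q L * excursionCount V p q v := by
  obtain ⟨B, hB, hB'⟩ := excursionCount_eq_tsum V p q v
  rw [treeCount_eq_tsum V L (fun a => a.count (m, m + 1)) (fun a => a.count (m + 1, m)), hB,
    ← ENNReal.tsum_mul_left, ← ENNReal.tsum_mul_left]
  refine tsum_congr fun ⟨r, s⟩ => ?_
  have h1 := treeCount_mul hm hL hp hq hw V r s
  have h2 := hB' r s
  have hN : ((p + s : ℕ) : ℝ≥0∞) ≠ 0 := by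
    rw [Nat.cast_ne_zero]
    omega
  refine (ENNReal.mul_right_inj hN (ENNReal.natCast_ne_top _)).1 ?_
  rw [mul_left_comm, h1, mul_left_comm _ (lowerWeight m q L) (B (r, s)), h2]
  ring

end TreeCount

/-! ### Probabilities of excursions in terms of counts. -/

section Weights

/-- Splitting at the root gives `F = 1 + F²/4` for the sum over all trees, with double root 2; the
empty tree accounts for 1. The value `∞` also solves this in `ℝ≥0∞` and is excluded by bounding the
sums over trees of bounded height. -/
theorem tsum_inv_four_pow_numNodes :
    ∑' t : {t : BTree // t ≠ .nil}, (4 : ℝ≥0∞)⁻¹ ^ t.1.numNodes = 1 := by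
  set f : BTree → ℝ≥0∞ := fun t => (4 : ℝ≥0∞)⁻¹ ^ t.numNodes with hf
  have hnode : ∀ l r : BTree, f (.node () l r) = (4 : ℝ≥0∞)⁻¹ * (f l * f r) := by
    intro l r
    simp only [hf, BinaryTree.numNodes]
    ring
  have hrec : ∑' t, f t = 1 + (4 : ℝ≥0∞)⁻¹ * ((∑' t, f t) * ∑' t, f t) := by
    conv_lhs => rw [tsum_tree]
    simp only [hnode, ENNReal.tsum_mul_left, ENNReal.tsum_prod', ENNReal.tsum_mul_right]
    simp [hf, BinaryTree.numNodes]
  have hbound : ∀ n, ∑' t, (if t.height ≤ n then f t else 0) ≤ 2 := by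
    intro n
    induction n with
    | zero =>
      rw [tsum_tree]
      simp [BinaryTree.height, hf, BinaryTree.numNodes]
    | succ n ih =>
      rw [tsum_tree, ENNReal.tsum_prod']
      have : ∀ l r : BTree, (if (BinaryTree.node () l r).height ≤ n + 1 then
          f (.node () l r) else 0) = (4 : ℝ≥0∞)⁻¹ *
            ((if l.height ≤ n then f l else 0) * (if r.height ≤ n then f r else 0)) := by
        intro l r
        rw [hnode]
        by_cases hl : l.height ≤ n <;> by_cases hr : r.height ≤ n <;>
          simp [BinaryTree.height, hl, hr]
      simp only [this, ENNReal.tsum_mul_left, ENNReal.tsum_mul_right]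
      have h1 : (if (BinaryTree.nil : BTree).height ≤ n + 1 then f .nil else 0) = 1 := by
        simp [BinaryTree.height, hf, BinaryTree.numNodes]
      rw [h1]
      calc (1 : ℝ≥0∞) + 4⁻¹ * ((∑' t, if t.height ≤ n then f t else 0) *
              ∑' t, if t.height ≤ n then f t else 0) ≤ 1 + 4⁻¹ * (2 * 2) := by gcongr
        _ = 2 := by
          rw [show (2 : ℝ≥0∞) * 2 = 4 by norm_num, ENNReal.inv_mul_cancel (by norm_num)
            (by norm_num)]
          norm_num
  have hle : ∑' t, f t ≤ 2 := by
    refine ENNReal.summable.tsum_le_of_sum_le fun s => ?_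
    refine le_trans ?_ (hbound (s.sup BinaryTree.height))
    refine le_trans (le_of_eq ?_) (ENNReal.sum_le_tsum s)
    exact Finset.sum_congr rfl fun t ht => (if_pos (Finset.le_sup ht)).symm
  have hfin : ∑' t, f t ≠ ⊤ := ne_top_of_le_ne_top (by norm_num) hle
  have htwo : ∑' t, f t = 2 := by
    have h := congrArg ENNReal.toReal hrec
    rw [ENNReal.toReal_add (by norm_num) (by finiteness), ENNReal.toReal_mul,
      ENNReal.toReal_mul, ENNReal.toReal_inv] at h
    norm_num at h
    rw [← ENNReal.toReal_eq_toReal_iff' hfin (by norm_num)]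
    norm_num
    nlinarith [sq_nonneg ((∑' t, f t).toReal - 2)]
  have hsplit := tsum_tree f
  rw [← tsum_nonempty_tree f, htwo] at hsplit
  have h1 : f .nil = 1 := by simp [hf, BinaryTree.numNodes]
  rw [h1, show (2 : ℝ≥0∞) = 1 + 1 by norm_num] at hsplit
  exact ((ENNReal.add_right_inj (by norm_num)).1 hsplit).symm

theorem numNodes_eq {t : BTree} (ht : t ≠ .nil) : t.numNodes = numEdges t + 1 := by
  cases t with
  | nil => exact absurd rfl ht
  | node a l r => simp [numEdges, BinaryTree.numNodes]

instance : Countable BTree := by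
  rw [← Set.countable_univ_iff]
  refine (Set.countable_iUnion fun n =>
    (BinaryTree.treesOfNumNodesEq n).countable_toSet).mono fun t _ => ?_
  exact Set.mem_iUnion.2 ⟨t.numNodes, BinaryTree.mem_treesOfNumNodesEq.2 rfl⟩

instance : DiscreteMeasurableSpace BTree := ⟨fun _ => trivial⟩

theorem tsum_inv_four_pow_card (m : ℤ) :
    ∑' t, (4 : ℝ≥0∞)⁻¹ ^ (rootedEdges m t).card = 4 := by
  have h : ∀ t : {t : BTree // t ≠ .nil}, (4 : ℝ≥0∞)⁻¹ ^ (rootedEdges m t).card =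
      4 * 4⁻¹ ^ t.1.numNodes := by
    intro t
    rw [rootedEdges, card_edges m t.2, numNodes_eq t.2, pow_succ', ← mul_assoc,
      ENNReal.mul_inv_cancel (by norm_num) (by norm_num), one_mul]
  simp only [h, ENNReal.tsum_mul_left, tsum_inv_four_pow_numNodes, mul_one]

/-- The fibre of the truncation over `τ` consists of all graftings at its vertices of label 0. Each
grafted tree, weighted by its edges, has total weight 4. -/
theorem excursionLaw_singleton (τ : truncated 1) :
    excursionLaw {τ.1} = 4 ^ zeroCount τ * 4⁻¹ ^ (numEdges τ + 1) := by
  have hset : excursionLaw {τ.1} = ∑' t : {t : BTree // t ≠ .nil},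
      if truncate 1 t = τ then (4 : ℝ≥0∞)⁻¹ ^ ((edges (0 + 1) t).card + 1) else 0 := by
    rw [excursionLaw, Measure.map_apply measurable_from_top (.of_discrete), treeLaw,
      Measure.sum_apply _ (.of_discrete)]
    refine tsum_congr fun t => ?_
    rw [Measure.smul_apply, Measure.dirac_apply' _ (.of_discrete), smul_eq_mul,
      card_edges _ t.2]
    by_cases h : truncate 1 t.1 = τ <;> simp [Set.indicator, h]
  have hnil : truncate 1 .nil ≠ τ.1 := fun h => τ.2.1 h.symm
  have hfib := tsum_truncate_fibre 0 1 τ.2.2 fun a => (4 : ℝ≥0∞)⁻¹ ^ (a.card + 1)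
  rw [tsum_tree, if_neg hnil, zero_add, ← tsum_nonempty_tree fun t => if truncate 1 t = τ then
    (4 : ℝ≥0∞)⁻¹ ^ ((edges (0 + 1) t).card + 1) else 0, ← hset] at hfib
  let w : Multiplicative (Multiset (ℤ × ℤ)) →* ℝ≥0∞ :=
    { toFun := fun a => 4⁻¹ ^ (Multiplicative.toAdd a).card
      map_one' := by simp
      map_mul' := fun a b => by simp [pow_add] }
  have hw := iterSum_multiplicative (rootedEdges 0) w ((labels (0 + 1) τ.1).count 0)
  have hw' : ∀ a : Multiset (ℤ × ℤ), w (Multiplicative.ofAdd a) = 4⁻¹ ^ a.card := fun _ => rfl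
  simp only [hw', tsum_inv_four_pow_card] at hw
  simp only [Multiset.card_add, card_edges _ τ.2.1, add_right_comm _ _ 1] at hfib
  simp only [pow_add _ (numEdges τ.1 + 1), iterSum_const_mul] at hfib
  rw [hfib, hw, mul_comm, zero_add, zeroCount]

theorem excursionLaw_singleton_of_notMem {t : BTree} (ht : t ∉ truncated 1) :
    excursionLaw {t} = 0 := by
  rw [excursionLaw, Measure.map_apply measurable_from_top (.of_discrete), treeLaw,
    Measure.sum_apply _ (.of_discrete), ENNReal.tsum_eq_zero]
  intro t'
  have h : truncate 1 t'.1 ≠ t := fun h => ht (h ▸ truncate_mem_truncated t'.2)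
  simp [h]

instance : IsProbabilityMeasure excursionLaw := by
  constructor
  rw [excursionLaw, Measure.map_apply measurable_from_top .univ, treeLaw,
    Measure.sum_apply _ (.of_discrete)]
  simp only [Measure.smul_apply, smul_eq_mul, Set.preimage_univ, measure_univ, mul_one]
  rw [← tsum_inv_four_pow_numNodes]
  exact tsum_congr fun t => by rw [numNodes_eq t.2]

theorem pi_excursionLaw_apply (V p q v : ℕ) :
    (Measure.pi fun _ : Fin p => excursionLaw)
        {τ | ∑ k, zeroCount (τ k) = q ∧
          ((∑ k, numEdges (τ k) : ℕ) : ℤ) = (V : ℤ) - v - p} =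
      4 ^ q * 4⁻¹ ^ (V - v) * excursionCount V p q v := by
  rw [← Measure.tsum_indicator_apply_singleton _ _ (.of_discrete), excursionCount,
    ← tsum_fin_eq_iterSum, ← ENNReal.tsum_mul_left]
  have hinj : Function.Injective fun (g : Fin p → truncated 1) (k : Fin p) => (g k).1 :=
    fun g g' h => funext fun k => Subtype.ext (congrFun h k)
  rw [← hinj.tsum_eq]
  · refine tsum_congr fun g => ?_
    have hfst : (∑ k, ((zeroCount (g k), numEdges (g k) + 1) : ℕ × ℕ)).1 =
        ∑ k, zeroCount (g k) := by rw [Prod.fst_sum]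
    have hsnd : (∑ k, ((zeroCount (g k), numEdges (g k) + 1) : ℕ × ℕ)).2 =
        ∑ k, (numEdges (g k) + 1) := by rw [Prod.snd_sum]
    have hsum : ∑ k, (numEdges (g k) + 1) = (∑ k, numEdges (g k)) + p := by
      simp [Finset.sum_add_distrib]
    rw [hfst, hsnd]
    by_cases h : (∑ k, zeroCount (g k) = q) ∧ ∑ k, (numEdges (g k) + 1) + v = V
    · rw [indic_of_true h, Set.indicator_of_mem, Measure.pi_singleton]
      · simp only [excursionLaw_singleton, Finset.prod_mul_distrib, Finset.prod_pow_eq_pow_sum]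
        rw [h.1, mul_one, ← h.2, Nat.add_sub_cancel]
      · refine ⟨h.1, ?_⟩
        have := h.2
        change ((∑ k, numEdges (g k) : ℕ) : ℤ) = _
        omega
    · rw [indic_of_false h, mul_zero, Set.indicator_of_notMem]
      intro h'
      refine h ⟨h'.1, ?_⟩
      have := h'.2
      dsimp only at this
      omega
  -- Tuples of positive probability consist of truncated trees.
  · intro f hf
    have hne : ∏ k, excursionLaw {f k} ≠ 0 := by
      rw [← Measure.pi_singleton]
      intro h
      refine hf ?_
      rw [Set.indicator_apply, h, ite_self]
    have hmem : ∀ k, f k ∈ truncated 1 := by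
      intro k
      by_contra hk
      exact hne (Finset.prod_eq_zero (Finset.mem_univ k) (excursionLaw_singleton_of_notMem hk))
    exact ⟨fun k => ⟨f k, hmem k⟩, rfl⟩

theorem jointLaw_eq (V p q v : ℕ) :
    jointLaw p q ((V : ℤ) - v - p) = 4 ^ q * 4⁻¹ ^ (V - v) * (excursionCount V p q v).toReal := by
  rw [jointLaw, Measure.real, pi_excursionLaw_apply]
  simp

end Weights

/-! ### The profile as a function of the edge multiset. -/

section Profile

/-- The triple `(X_m^+, X_m^-, M_m^-)` as a function of the multiset of edges. -/
def edgeProfile (m : ℕ) (a : Multiset (ℤ × ℤ)) : ℕ × ℕ × ℕ :=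
  (a.count ((m : ℤ) - 1, (m : ℤ)), a.count ((m : ℤ), (m : ℤ) - 1),
    a.countP fun e => e.1 ≤ (m : ℤ) - 1 ∧ e.2 ≤ (m : ℤ) - 1)

/-- Up to level `m` the profile sees only edges with an endpoint below `m`, so events of the past
ignore upper pieces. -/
theorem edgeProfile_add_high {m k : ℕ} (hk : k ≤ m) (a : Multiset (ℤ × ℤ)) {b : Multiset (ℤ × ℤ)}
    (hb : b ∈ highEdges m) : edgeProfile k (a + b) = edgeProfile k a := by
  have h1 : b.count ((k : ℤ) - 1, (k : ℤ)) = 0 :=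
    count_eq_zero_of_high hb (Or.inl (by dsimp only; omega))
  have h2 : b.count ((k : ℤ), (k : ℤ) - 1) = 0 :=
    count_eq_zero_of_high hb (Or.inr (by dsimp only; omega))
  have h3 : (b.countP fun e => e.1 ≤ (k : ℤ) - 1 ∧ e.2 ≤ (k : ℤ) - 1) = 0 := by
    rw [Multiset.countP_eq_zero]
    intro e he h
    have := (hb e he).1
    omega
  simp only [edgeProfile, Multiset.count_add, Multiset.countP_add, h1, h2, h3, add_zero]

theorem countP_le_eq (m : ℤ) {a : Multiset (ℤ × ℤ)} (ha : a ∈ adjacentPairs fun _ => True) :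
    (a.countP fun e => e.1 ≤ m ∧ e.2 ≤ m) =
      (a.countP fun e => e.1 ≤ m - 1 ∧ e.2 ≤ m - 1) + a.count (m - 1, m) + a.count (m, m - 1) := by
  induction a using Multiset.induction_on with
  | empty => simp
  | cons e a ih =>
    have he := (ha e (Multiset.mem_cons_self e a)).2
    have := ih fun e' he' => ha e' (Multiset.mem_cons_of_mem he')
    rw [Multiset.countP_cons, Multiset.countP_cons, Multiset.count_cons, Multiset.count_cons, this]
    obtain ⟨x, y⟩ := e
    simp only [Prod.mk.injEq] at he ⊢
    split_ifs <;> omega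

theorem edgeProfile_succ (m : ℕ) {a : Multiset (ℤ × ℤ)} (ha : a ∈ adjacentPairs fun _ => True) :
    edgeProfile (m + 1) a = (a.count ((m : ℤ), (m : ℤ) + 1), a.count ((m : ℤ) + 1, (m : ℤ)),
      (edgeProfile m a).2.2 + (edgeProfile m a).1 + (edgeProfile m a).2.1) := by
  simp only [edgeProfile, Nat.cast_add, Nat.cast_one, add_sub_cancel_right,
    ← countP_le_eq (m : ℤ) ha]

theorem card_of_low {m : ℕ} {a : Multiset (ℤ × ℤ)} (ha : a ∈ lowEdges m) :
    a.card = (edgeProfile m a).2.2 + (edgeProfile m a).1 + (edgeProfile m a).2.1 := by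
  have h := countP_le_eq (m : ℤ) (adjacentPairs_le_true ha)
  rw [Multiset.countP_eq_card.2 fun e he => (ha e he).1] at h
  exact h

/-- All edges lie below level `m`, so `(0, 0, V)` is absorbing. -/
theorem edgeProfile_succ_of_full {m V : ℕ} {a : Multiset (ℤ × ℤ)} (hc : a.card = V)
    (ha : a ∈ adjacentPairs fun _ => True) (h : edgeProfile m a = (0, 0, V)) :
    edgeProfile (m + 1) a = (0, 0, V) := by
  have h3 : (edgeProfile m a).2.2 = V := by rw [h]
  have hall := Multiset.countP_eq_card.1 (h3.trans hc.symm)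
  rw [edgeProfile_succ m ha, h, Multiset.count_eq_zero.2, Multiset.count_eq_zero.2]
  · simp
  all_goals
    intro he
    have := hall _ he
    dsimp only at this
    omega

end Profile

/-! ### Conditional probabilities as ratios of counts. -/

section Uniform

theorem treeCount_congr {V : ℕ} {P Q : Multiset (ℤ × ℤ) → Prop}
    (h : ∀ a ∈ adjacentPairs fun _ => True, a.card = V → (P a ↔ Q a)) :
    treeCount V P = treeCount V Q := by
  refine tsum_congr fun t => congrArg indic (propext ?_)
  exact and_congr_right fun hc => h _ (edges_mem_adjacentPairs 0 t.1) hc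

theorem treeCount_false {V : ℕ} : treeCount V (fun _ => False) = 0 := by
  simp [treeCount, indic]

theorem count_trees (V : ℕ) (P : Multiset (ℤ × ℤ) → Prop) :
    Measure.count ({t : BTree | t ≠ .nil ∧ numEdges t = V} ∩ {t | P (edges 0 t)}) =
      treeCount V P := by
  rw [← Measure.tsum_indicator_apply_singleton _ _ (.of_discrete), tsum_tree,
    Set.indicator_of_notMem (by simp), zero_add, treeCount,
    tsum_nonempty_tree fun t => indic ((edges 0 t).card = V ∧ P (edges 0 t))]
  classical
  refine tsum_congr fun lr => ?_
  rw [card_edges 0 (by simp), Set.indicator_apply, Measure.count_singleton]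
  by_cases h : numEdges (.node () lr.1 lr.2) = V ∧ P (edges 0 (.node () lr.1 lr.2))
  · rw [indic_of_true h, if_pos ⟨⟨by simp, h.1⟩, h.2⟩]
  · rw [indic_of_false h, if_neg fun h' => h ⟨h'.1.2, h'.2⟩]

theorem finite_trees (V : ℕ) : {t : BTree | t ≠ .nil ∧ numEdges t = V}.Finite := by
  refine (BinaryTree.treesOfNumNodesEq (V + 1)).finite_toSet.subset fun t ht => ?_
  rw [Finset.mem_coe, BinaryTree.mem_treesOfNumNodesEq, numNodes_eq ht.1, ht.2]

theorem treeCount_ne_top (V : ℕ) (P : Multiset (ℤ × ℤ) → Prop) : treeCount V P ≠ ⊤ := by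
  rw [← count_trees]
  exact (Measure.count_apply_lt_top.2 ((finite_trees V).inter_of_left _)).ne

theorem uniformTree_apply (V : ℕ) (P : Multiset (ℤ × ℤ) → Prop) :
    uniformTree V {t | P (edges 0 t)} =
      (Measure.count {t : BTree | t ≠ .nil ∧ numEdges t = V})⁻¹ * treeCount V P := by
  rw [uniformTree, uniformOn, cond_apply .of_discrete, count_trees]

theorem cond_uniformTree_real (V : ℕ) (P Q : Multiset (ℤ × ℤ) → Prop)
    (hpos : 0 < uniformTree V {t | P (edges 0 t)}) :
    (cond (uniformTree V) {t | P (edges 0 t)}).real {t | Q (edges 0 t)} =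
      (treeCount V fun a => P a ∧ Q a).toReal / (treeCount V P).toReal := by
  have hinter : ({t | P (edges 0 t)} ∩ {t | Q (edges 0 t)} : Set BTree) =
      {t | P (edges 0 t) ∧ Q (edges 0 t)} := rfl
  rw [uniformTree_apply] at hpos
  rw [Measure.real, cond_apply .of_discrete, hinter, uniformTree_apply V P,
    uniformTree_apply V fun a => P a ∧ Q a]
  set c := Measure.count {t : BTree | t ≠ .nil ∧ numEdges t = V}
  have h1 : c⁻¹ ≠ 0 := left_ne_zero_of_mul hpos.ne'
  have h2 : c⁻¹ ≠ ⊤ := by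
    intro h
    have hc : c = 0 := ENNReal.inv_eq_top.1 h
    have hP : treeCount V P = 0 := by
      rw [← count_trees]
      exact measure_mono_null Set.inter_subset_left hc
    rw [hP, mul_zero] at hpos
    exact lt_irrefl _ hpos
  simp only [ENNReal.toReal_mul, ENNReal.toReal_inv]
  have h3 : c.toReal ≠ 0 := by
    have := ENNReal.toReal_ne_zero.2 ⟨h1, h2⟩
    rw [ENNReal.toReal_inv] at this
    exact fun h => this (by rw [h, inv_zero])
  field_simp

end Uniform

/-! ### The transition kernel. -/

section Transition

/-- The transition probability from `(p, q, v)` to `(r, s, w)`. -/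
def transition (V p q v r s w : ℕ) : ℝ :=
  if w = v + p + q then
    if p = 0 ∧ q = 0 ∧ r = 0 ∧ s = 0 then 1
    else (p : ℝ) * (4 : ℝ) ^ (-(p : ℤ) - (s : ℤ)) / ((p : ℝ) + (s : ℝ))
      * ((p + s).choose r : ℝ) * ((p + s).choose q : ℝ)
      * (jointLaw r s ((V : ℤ) - w - r) / jointLaw p q ((V : ℤ) - v - p))
  else 0

theorem excursionCount_of_lt {V r s w : ℕ} (h : V < w) : excursionCount V r s w = 0 := by
  rw [excursionCount, ← iterSum_fun_zero (fun τ : truncated 1 => (zeroCount τ, numEdges τ + 1)) r]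
  congr 1
  funext x
  exact indic_of_false fun h' => by omega

/-- The exponents of 4 in `jointLaw_eq` differ by `s - q + w - v = p + s`. -/
theorem jointLaw_ratio {V p q v r s w : ℕ} (hw : w = v + p + q) :
    (4 : ℝ) ^ (-(p : ℤ) - (s : ℤ)) *
        (jointLaw r s ((V : ℤ) - w - r) / jointLaw p q ((V : ℤ) - v - p)) =
      (excursionCount V r s w).toReal / (excursionCount V p q v).toReal := by
  rw [jointLaw_eq, jointLaw_eq]
  -- For `V < w` the natural subtraction `V - w` is truncated, but the count vanishes.
  rcases lt_or_ge V w with h | h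
  · simp [excursionCount_of_lt h]
  · obtain ⟨c, rfl⟩ := Nat.exists_eq_add_of_le h
    have e1 : w + c - w = c := by omega
    have e2 : w + c - v = c + p + q := by omega
    rw [e1, e2, zpow_sub₀ (by norm_num), zpow_neg, zpow_natCast, zpow_natCast]
    simp only [pow_add, inv_pow]
    field_simp

/-- Allowing any `L` that ignores upper pieces and fixes the profile at `m` treats conditioning on
the present and on the whole past at once. -/
theorem jointLaw_pos_and_cond_eq (V : ℕ) {m : ℕ} (hm : 1 ≤ m) {p q v r s w : ℕ}
    (hx : (p, q, v) ∈ stateSpace V) (hy : (r, s, w) ∈ stateSpace V)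
    {L : Multiset (ℤ × ℤ) → Prop} (hL : ∀ a, ∀ b ∈ highEdges m, L (a + b) ↔ L a)
    (hLm : ∀ a, L a → edgeProfile m a = (p, q, v))
    (hpos : 0 < uniformTree V {t | L (edges 0 t)}) :
    0 < jointLaw p q ((V : ℤ) - v - p) ∧
      (cond (uniformTree V) {t | L (edges 0 t)}).real {t | profile (m + 1) t = (r, s, w)} =
        transition V p q v r s w := by
  have hne : treeCount V L ≠ 0 := by
    rw [uniformTree_apply] at hpos
    exact right_ne_zero_of_mul hpos.ne'
  have hn : (treeCount V L).toReal ≠ 0 := ENNReal.toReal_ne_zero.2 ⟨hne, treeCount_ne_top V L⟩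
  have hcond := cond_uniformTree_real V L (fun a => edgeProfile (m + 1) a = (r, s, w)) hpos
  change (cond (uniformTree V) {t | L (edges 0 t)}).real {t | profile (m + 1) t = (r, s, w)} =
    _ at hcond
  rw [hcond, transition]
  have hsucc : ∀ a ∈ adjacentPairs fun _ => True, L a → edgeProfile (m + 1) a =
      (a.count ((m : ℤ), (m : ℤ) + 1), a.count ((m : ℤ) + 1, (m : ℤ)), v + p + q) := by
    intro a ha hLa
    rw [edgeProfile_succ m ha, hLm a hLa]
  rcases Nat.eq_zero_or_pos p with rfl | hp
  · have hqv : q = 0 ∧ v = V := by simpa [stateSpace] using hx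
    obtain ⟨rfl, rfl⟩ := hqv
    constructor
    · rw [jointLaw_eq]
      simp [excursionCount, iterSum, indic]
    · simp only [add_zero, true_and]
      have hyw : (r, s, w) = (0, 0, v) ∨ 0 < r := by
        rcases hy with hy | hy
        · exact Or.inr hy.1
        · exact Or.inl hy
      rcases hyw with hyw | hr
      · simp only [Prod.mk.injEq] at hyw
        obtain ⟨rfl, rfl, rfl⟩ := hyw
        rw [treeCount_congr (Q := L), div_self hn]
        · simp
        · exact fun a ha hc =>
            ⟨fun h => h.1, fun h => ⟨h, edgeProfile_succ_of_full hc ha (hLm a h)⟩⟩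
      -- Here the factor `p = 0` makes the formula vanish, also for `s = 0`, where division by zero
      -- gives 0.
      · rw [treeCount_congr (Q := fun _ => False), treeCount_false]
        · simp [hr.ne']
        · intro a ha hc
          simp only [iff_false, not_and]
          intro h
          rw [edgeProfile_succ_of_full hc ha (hLm a h)]
          intro h'
          simp only [Prod.mk.injEq] at h'
          omega
  · have hm0 : (0 : ℤ) < m := by omega
    have hp' : ∀ a, L a → a.count ((m : ℤ) - 1, (m : ℤ)) = p := fun a h =>
      congrArg Prod.fst (hLm a h)
    have hq' : ∀ a, L a → a.count ((m : ℤ), (m : ℤ) - 1) = q := fun a h =>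
      congrArg (fun x => x.2.1) (hLm a h)
    have hw' : ∀ a ∈ lowEdges m, L a → a.card = v + p + q := fun a ha h => by
      rw [card_of_low ha, hLm a h]
    have hA := congrArg ENNReal.toReal (treeCount_mul_eq hm0 hp hL hp' hq' hw' V)
    have hB := congrArg ENNReal.toReal (treeCount_mul hm0 hL hp' hq' hw' V r s)
    simp only [ENNReal.toReal_mul, ENNReal.toReal_natCast] at hA hB
    have hpR : (p : ℝ) ≠ 0 := by positivity
    -- A nonzero count forces both factors in `treeCount_mul_eq` to be nonzero, which gives the
    -- positivity of the denominator.
    have hprod := mul_ne_zero hpR hn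
    rw [hA] at hprod
    have hK := left_ne_zero_of_mul hprod
    have hE := right_ne_zero_of_mul hprod
    constructor
    · rw [jointLaw_eq]
      have := ENNReal.toReal_nonneg.lt_of_ne' hE
      positivity
    · split_ifs with hw h0
      · omega
      · rw [treeCount_congr
          (Q := fun a => L a ∧ a.count ((m : ℤ), (m : ℤ) + 1) = r ∧
            a.count ((m : ℤ) + 1, (m : ℤ)) = s)]
        · have hratio := jointLaw_ratio (V := V) (r := r) (s := s) hw
          have hps : (p : ℝ) + s ≠ 0 := by positivity
          have hn' : (treeCount V L).toReal = (lowerWeight m q L).toReal *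
              (excursionCount V p q v).toReal / p := by
            rw [← hA]
            field_simp
          rw [show (p : ℝ) * (4 : ℝ) ^ (-(p : ℤ) - (s : ℤ)) / ((p : ℝ) + (s : ℝ))
              * ((p + s).choose r : ℝ) * ((p + s).choose q : ℝ)
              * (jointLaw r s ((V : ℤ) - w - r) / jointLaw p q ((V : ℤ) - v - p)) =
              p / ((p : ℝ) + s) * ((p + s).choose r : ℝ) * ((p + s).choose q : ℝ) *
                ((4 : ℝ) ^ (-(p : ℤ) - (s : ℤ)) * (jointLaw r s ((V : ℤ) - w - r) /
                  jointLaw p q ((V : ℤ) - v - p))) by ring, hratio, hn', hw]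
          rw [Nat.cast_add, mul_comm, ← eq_div_iff hps] at hB
          rw [hB]
          field_simp
        · intro a ha hc
          refine and_congr_right fun h => ?_
          rw [hsucc a ha h, hw]
          simp only [Prod.mk.injEq, and_true]
      · rw [treeCount_congr (Q := fun _ => False), treeCount_false]
        · simp
        · intro a ha hc
          simp only [iff_false, not_and]
          intro h
          rw [hsucc a ha h]
          intro h'
          simp only [Prod.mk.injEq] at h'
          omega

end Transition

end EdgeProfile

end

theorem theorem5p3 (V : ℕ) (hV : 1 ≤ V) (p q v r s w : ℕ)
    (hx : (p, q, v) ∈ EdgeProfile.stateSpace V) (hy : (r, s, w) ∈ EdgeProfile.stateSpace V)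
    (m : ℕ) (hm : 1 ≤ m)
    (hpos : 0 < EdgeProfile.uniformTree V {t | EdgeProfile.profile m t = (p, q, v)}) :
    -- the denominator in the formula does not vanish
    0 < EdgeProfile.jointLaw p q ((V : ℤ) - v - p) ∧
    -- the one-step transition probability
    (ProbabilityTheory.cond (EdgeProfile.uniformTree V)
        {t | EdgeProfile.profile m t = (p, q, v)}).real
          {t | EdgeProfile.profile (m + 1) t = (r, s, w)} =
      (if w = v + p + q then
        if p = 0 ∧ q = 0 ∧ r = 0 ∧ s = 0 then 1
        else (p : ℝ) * (4 : ℝ) ^ (-(p : ℤ) - (s : ℤ)) / ((p : ℝ) + (s : ℝ))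
          * ((p + s).choose r : ℝ) * ((p + s).choose q : ℝ)
          * (EdgeProfile.jointLaw r s ((V : ℤ) - w - r) /
              EdgeProfile.jointLaw p q ((V : ℤ) - v - p))
      else 0) ∧
    -- it is also the transition probability given the whole past (Markov property)
    ∀ past : ℕ → ℕ × ℕ × ℕ, past m = (p, q, v) →
      0 < EdgeProfile.uniformTree V
        {t | ∀ k ∈ Finset.Icc 1 m, EdgeProfile.profile k t = past k} →
      (ProbabilityTheory.cond (EdgeProfile.uniformTree V)
          {t | ∀ k ∈ Finset.Icc 1 m, EdgeProfile.profile k t = past k}).real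
            {t | EdgeProfile.profile (m + 1) t = (r, s, w)} =
        (ProbabilityTheory.cond (EdgeProfile.uniformTree V)
          {t | EdgeProfile.profile m t = (p, q, v)}).real
            {t | EdgeProfile.profile (m + 1) t = (r, s, w)} := by
  have h := EdgeProfile.jointLaw_pos_and_cond_eq V hm hx hy
    (L := fun a => EdgeProfile.edgeProfile m a = (p, q, v))
    (fun a b hb => by rw [EdgeProfile.edgeProfile_add_high le_rfl a hb]) (fun a ha => ha) hpos
  refine ⟨h.1, h.2, fun past hpast hpos' => ?_⟩
  have h' := EdgeProfile.jointLaw_pos_and_cond_eq V hm hx hy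
    (L := fun a => ∀ k ∈ Finset.Icc 1 m, EdgeProfile.edgeProfile k a = past k)
    (fun a b hb => forall₂_congr fun k hk => by
      rw [EdgeProfile.edgeProfile_add_high (Finset.mem_Icc.1 hk).2 a hb])
    (fun a ha => (ha m (Finset.mem_Icc.2 ⟨hm, le_rfl⟩)).trans hpast) hpos'
  exact h'.2.trans h.2.symm
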